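/- **Setting.** Consider a robust MDP with states $\mathcal S=\{1,\dots,S\}$, actions $\mathcal A=\{1,\dots,A\}$ ($S,A\ge 1$), rewards $\bm r_{s,a}\in\mathbb R^S$, discount factor $\gamma\in(0,1)$, nominal transition probabilities $\bar{\bm p}_{s,a}\in\Delta^S$, strictly positive weights $\bm w_{s,a}\in\mathbb R^S$ and budgets $\kappa_s\ge 0$. Let $\|\bm x\|_{1,\bm w}=\sum_i w_i|x_i|$. For $\bm v\in\mathbb R^S$ the s-rectangular robust Bellman optimality operator is $$(\mathfrak L\bm v)_s=\max_{\bm d\in\Delta^A}\ \min_{\bm p\in(\Delta^S)^A}\Bigl\{\sum_{a} d_a\,\bm p_a^\top(\bm r_{s,a}+\gamma\bm v)\ :\ \sum_{a}\|\bm p_a-\bar{\bm p}_{s,a}\|_{1,\bm w_{s,a}}\le\kappa_s\Bigr\}.$$ **Homotopy method** (for one action; input $\bm z,\bm w,\bar{\bm p}\in\mathbb R^S$). Start with $\xi_0=0$, $\bm p=\bar{\bm p}$, $q_0=\bar{\bm p}^\top\bm z$. For all $i\ne j$ form the slopes $\alpha_{ij}=(z_i-z_j)/(w_i+w_j)$ (class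 C1: receiver $i$, donor $j$) and, if $w_i\neq w_j$, $\beta_{ij}=(z_i-z_j)/(w_i-w_j)$ (class C2: of $i,j$, the one with the larger weight is the receiver, the other one the donor). Sort the negative ones in ascending order; among equal slopes C1 comes before C2, and C2 is ordered by increasing weight of the donor. Go through the sorted list. At step $l$, if $p_i\in[\bar p_i,1]$ and $p_j\in[0,\bar p_j]$ (C1), respectively $p_i\in[\bar p_i,1]$ and $p_j\in[\bar p_j,1]$ (C2), let $\xi$ grow by the largest $\Delta\xi\geq 0$ such that the donor's component, which decreases at rate $1/(w_i+w_j)$ (C1) or $1/|w_i-w_j|$ (C2) while the receiver's increases at the same rate, stays at least $0$ (C1) or at least its nominal value (C2); update $\bm p$, $\xi_l=\xi_{l-1}+\Delta\xi$ and $q_l=q_{l-1}+\Delta\xi\cdot\text{slope}$. Otherwise put $(\xi_l,q_l)=(\xi_{l-1},q_{l-1})$. Return all points $(\xi_t,q_t)_{t=0,\dots,T}$. **Bisection method** (input: $\kappa=\kappa_s$ and, for each action $a$, the points $(\xi^a_t,q^a_t)_{t=0,\dots,T_a}$ of the homotopy method run on $\bm z=\bm r_{s,a}+\gamma\bm v$,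 $\bm w_{s,a}$, $\bar{\bm p}_{s,a}$). Let $q_a^{-1}$ be the inverse, evaluated by binary search, of the piecewise affine function through these points, with $q_a^{-1}(u)=0$ for $u\ge q^a_0$ and $q_a^{-1}(u)=\infty$ for $u<q^a_{T_a}$. Sort all values $q^a_t$ into one list $\hat q_1<\dots<\hat q_K$ without duplicates. Starting with $k_{\min}=1$, $k_{\max}=K$, as long as $k_{\max}-k_{\min}>1$ let $k=\operatorname{round}((k_{\min}+k_{\max})/2)$ and set $k_{\max}\gets k$ if $\sum_a q_a^{-1}(\hat q_k)\le\kappa$, and $k_{\min}\gets k$ otherwise. Let $u_{\min},u_{\max}$ be the two values left and $s_{\min},s_{\max}$ the values of $\sum_a q_a^{-1}$ there. Return $u_{\max}$ if $s_{\min}=\infty$, $u_{\min}$ if $s_{\min}\le\kappa$, and otherwise $(1-\alpha)u_{\min}+\alpha u_{\max}$ with $\alpha=(\kappa-s_{\min})/(s_{\max}-s_{\min})$. **Theorem.** For every such robust MDP, every $\bm v\in\mathbb R^S$ and every state $s$, running the homotopy method for each action and then the bisection method returns exactly $(\mathfrak L\bm v)_s$. Moreover there is an absolute constant $C$ such that,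 whenever $SA\ge 2$, the total number of elementary steps (real arithmetic operations, comparisons, memory accesses, index operations, on a unit-cost random access machine over the reals, sorting by merge sort) is at most $$C\,\bigl(S^2A\log(SA)+A\,\log S\,\log(SA)\bigr).$$ -/

import Mathlib

/-! ### Robust Markov decision processes with s-rectangular weighted `L₁` ambiguity sets -/

/-- The data of an s-rectangular robust MDP with states `Fin S` and actions `Fin A`, whose ambiguity
sets are weighted `L₁`-balls around the nominal transition probabilities `pbar`. -/
structure RMDP (S A : ℕ) where
  /-- initial distribution -/
  p₀ : Fin S → ℝ
  p₀_mem : p₀ ∈ stdSimplex ℝ (Fin S)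
  /-- nominal transition probabilities `pbar s a s'` -/
  pbar : Fin S → Fin A → Fin S → ℝ
  pbar_mem : ∀ s a, pbar s a ∈ stdSimplex ℝ (Fin S)
  /-- rewards `r s a s'` -/
  r : Fin S → Fin A → Fin S → ℝ
  /-- discount factor -/
  γ : ℝ
  γ_pos : 0 < γ
  γ_lt_one : γ < 1
  /-- weights of the `L₁`-norms -/
  w : Fin S → Fin A → Fin S → ℝ
  w_pos : ∀ s a i, 0 < w s a i
  /-- budgets -/
  κ : Fin S → ℝ
  κ_nonneg : ∀ s, 0 ≤ κ s

/-- The weighted `L₁`-norm `∑ i, w i * |x i|`. -/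
def weightedL1 {S : ℕ} (w x : Fin S → ℝ) : ℝ := ∑ i, w i * |x i|

namespace RMDP

variable {S A : ℕ}

/-- The ambiguity set of the state `s`: one budget `κ s` is shared by all actions. -/
def ambiguitySet (M : RMDP S A) (s : Fin S) : Set (Fin A → Fin S → ℝ) :=
  {p | (∀ a, p a ∈ stdSimplex ℝ (Fin S)) ∧
    ∑ a, weightedL1 (M.w s a) (p a - M.pbar s a) ≤ M.κ s}

/-- The s-rectangular robust Bellman optimality operator: the maximum over randomized actions `d`
of the minimum over `p` in the ambiguity set of `∑ a, d a * p aᵀ (r s a + γ v)`. (For `0 < A` both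
extrema are over nonempty compact sets.) -/
noncomputable def robustBellman (M : RMDP S A) (v : Fin S → ℝ) (s : Fin S) : ℝ :=
  sSup ((fun d : Fin A → ℝ =>
      sInf ((fun p : Fin A → Fin S → ℝ => ∑ a, d a * ∑ i, p a i * (M.r s a i + M.γ * v i)) ''
        M.ambiguitySet s)) ''
    stdSimplex ℝ (Fin A))

end RMDP

/-! ### Cost model

A program for a unit-cost real random access machine is written in the monad `Timed`, which carries
the number of elementary steps along with the result. Exact arithmetic operations on reals,
comparisons, reads and writes of array cells and the creation of list cells take one step each.
Index arithmetic and loop control are charged by explicit `tick`s. -/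

/-- A computation: its result and the number of elementary steps that it takes. -/
structure Timed (α : Type) where
  val : α
  steps : ℕ

namespace Timed

instance : Monad Timed where
  pure x := ⟨x, 0⟩
  bind m f := ⟨(f m.val).val, m.steps + (f m.val).steps⟩

/-- Spend `n` steps. -/
def tick (n : ℕ) : Timed Unit := ⟨(), n⟩

def add (x y : ℝ) : Timed ℝ := ⟨x + y, 1⟩
def sub (x y : ℝ) : Timed ℝ := ⟨x - y, 1⟩
def mul (x y : ℝ) : Timed ℝ := ⟨x * y, 1⟩
noncomputable def div (x y : ℝ) : Timed ℝ := ⟨x / y, 1⟩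
noncomputable def le (x y : ℝ) : Timed Bool := ⟨decide (x ≤ y), 1⟩
noncomputable def lt (x y : ℝ) : Timed Bool := ⟨decide (x < y), 1⟩
def both (b c : Bool) : Timed Bool := ⟨b && c, 1⟩

/-- Add a cell in front of a linked list. -/
def cons {α : Type} (x : α) (l : List α) : Timed (List α) := ⟨x :: l, 1⟩

/-- Allocate an array with `n` cells. -/
def alloc {α : Type} (n : ℕ) (x : α) : Timed (Fin n → α) := ⟨fun _ => x, n⟩

/-- Make a copy of an array with `n` cells. -/
def copy {α : Type} {n : ℕ} (f : Fin n → α) : Timed (Fin n → α) := ⟨f, n⟩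

/-- Read a cell of an array. -/
def readCell {α : Type} {n : ℕ} (f : Fin n → α) (i : Fin n) : Timed α := ⟨f i, 1⟩

/-- Write a cell of an array, in place: no program below uses the old array afterwards. -/
def writeCell {α : Type} {n : ℕ} (f : Fin n → α) (i : Fin n) (x : α) : Timed (Fin n → α) :=
  ⟨Function.update f i x, 1⟩

/-- Store a list in an array of variable size. -/
def store {α : Type} (l : List α) : Timed (Array α) := ⟨l.toArray, l.length + 1⟩

/-- Read a cell of an array of variable size (`x` is returned when out of bounds). -/
def readAt {α : Type} (l : Array α) (k : ℕ) (x : α) : Timed α := ⟨l.getD k x, 1⟩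

/-- `for x in l do body`, with the loop state passed along; one step of control per iteration. -/
def forEach {α σ : Type} (body : σ → α → Timed σ) : List α → σ → Timed σ
  | [], st => do
    tick 1
    return st
  | x :: l, st => do
    tick 1
    let st ← body st x
    forEach body l st

/-- `for i = 0, …, n - 1 do body`. -/
def forFin {σ : Type} (n : ℕ) (body : σ → Fin n → Timed σ) (st : σ) : Timed σ :=
  forEach body (List.finRange n) st

/-- Merge two sorted lists. -/
def merge {α : Type} (cmp : α → α → Timed Bool) : List α → List α → Timed (List α)
  | [], l => do
    tick 1
    return l
  | x :: k, [] => do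
    tick 1
    return x :: k
  | x :: k, y :: l => do
    tick 1
    if (← cmp x y) then
      let t ← merge cmp k (y :: l)
      cons x t
    else
      let t ← merge cmp (x :: k) l
      cons y t
  termination_by k l => k.length + l.length

/-- Merge sort; computing the length and splitting in half are charged `2 * l.length`. -/
def mergeSort {α : Type} (cmp : α → α → Timed Bool) (l : List α) : Timed (List α) :=
  if h : l.length ≤ 1 then do
    tick 1
    return l
  else do
    tick (1 + 2 * l.length)
    let k₁ ← mergeSort cmp (l.take (l.length / 2))
    let k₂ ← mergeSort cmp (l.drop (l.length / 2))
    merge cmp k₁ k₂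
  termination_by l.length
  decreasing_by
    · simp only [List.length_take]; omega
    · simp only [List.length_drop]; omega

/-- Bisection of the index range `lo, …, hi`, until `lo` and `hi` are at most one apart: the middle
index (rounded up) replaces `hi` if it passes the test, and `lo` otherwise. -/
def bisect (test : ℕ → Timed Bool) (lo hi : ℕ) : Timed (ℕ × ℕ) :=
  if h : hi - lo ≤ 1 then do
    tick 2
    return (lo, hi)
  else do
    tick 5
    if (← test ((lo + hi + 1) / 2)) then
      bisect test lo ((lo + hi + 1) / 2)
    else
      bisect test ((lo + hi + 1) / 2) hi
  termination_by hi - lo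
  decreasing_by
    · omega
    · omega

/-- Remove the duplicates from a sorted list. -/
noncomputable def dropDuplicates : List ℝ → Timed (List ℝ)
  | [] => do
    tick 1
    return []
  | [x] => do
    tick 1
    return [x]
  | x :: y :: l => do
    tick 1
    let t ← dropDuplicates (y :: l)
    if (← lt x y) then cons x t else return t

/-- Test `x ≤ y ≤ z`. -/
noncomputable def between (x y z : ℝ) : Timed Bool := do
  let b ← le x y
  let c ← le y z
  both b c

end Timed

/-! ### The homotopy method -/

namespace HomotopyMethod

open Timed

variable {S : ℕ}

/-- A candidate basis: class (C1) has `𝓤 = {i}` and `𝓛 = {j}`, class (C2) has `𝓤 = {i, j}` and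
`𝓛 = ∅`. `slope` is the derivative of the objective along the basis. `tie` orders bases of equal
slope: it is `0` for (C1) and the weight of the donor, `min (w i) (w j) > 0`, for (C2). -/
structure Basis (S : ℕ) where
  slope : ℝ
  tie : ℝ
  isC2 : Bool
  i : Fin S
  j : Fin S

/-- Order the bases by slope, and bases of the same slope by `tie`. -/
noncomputable def Basis.cmp (b c : Basis S) : Timed Bool := do
  if (← lt b.slope c.slope) then
    return true
  else if (← lt c.slope b.slope) then
    return false
  else
    le b.tie c.tie

/-- Add the bases of the pair `(i, j)` that have a negative slope to the list `D`. -/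
noncomputable def addBases (z w : Fin S → ℝ) (D : List (Basis S)) (i j : Fin S) :
    Timed (List (Basis S)) := do
  tick 1
  if i = j then
    return D
  else
    let zi ← readCell z i
    let zj ← readCell z j
    let wi ← readCell w i
    let wj ← readCell w j
    let dz ← sub zi zj
    let ws ← add wi wj
    let α ← div dz ws
    let D ← if (← lt α 0) then cons ⟨α, 0, false, i, j⟩ D else pure D
    if (← lt wj wi) then
      let wd ← sub wi wj
      let β ← div dz wd
      if (← lt β 0) then cons ⟨β, wj, true, i, j⟩ D else return D
    else if (← lt wi wj) then
      let wd ← sub wi wj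
      let β ← div dz wd
      if (← lt β 0) then cons ⟨β, wi, true, i, j⟩ D else return D
    else
      return D

/-- All bases with a negative slope, in ascending order. -/
noncomputable def sortedBases (z w : Fin S → ℝ) : Timed (List (Basis S)) := do
  let D ← forFin S (fun D i => forFin S (fun D j => addBases z w D i j) D) []
  mergeSort Basis.cmp D

/-- State of the tracing loop: current `ξ`, `p`, `q`, and the points `(ξ_t, q_t)` recorded so far,
the most recent one first. -/
structure State (S : ℕ) where
  ξ : ℝ
  q : ℝ
  p : Fin S → ℝ
  points : List (ℝ × ℝ)

/-- Follow a basis of the given slope, in which the receiver `r` gains and the donor `d` loses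
probability at the rate `1 / W`, up to the largest step `Δ` for which `p d` stays at least
`floor`. -/
noncomputable def follow (st : State S) (slope W floor : ℝ) (r d : Fin S) : Timed (State S) := do
  let rate ← div 1 W
  let pr ← readCell st.p r
  let pd ← readCell st.p d
  let slack ← sub pd floor
  let Δ ← div slack rate
  let m ← mul Δ rate
  let pr' ← add pr m
  let pd' ← sub pd m
  let p ← writeCell st.p r pr'
  let p ← writeCell p d pd'
  let ξ ← add st.ξ Δ
  let g ← mul Δ slope
  let q ← add st.q g
  let points ← cons (ξ, q) st.points
  return ⟨ξ, q, p, points⟩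

/-- One iteration of the tracing loop. A basis of class (C1) is feasible at the current `p` if
`p i ∈ [pbar i, 1]` and `p j ∈ [0, pbar j]`, one of class (C2) if `p i ∈ [pbar i, 1]` and
`p j ∈ [pbar j, 1]`. An infeasible basis is skipped, and the last point repeated. -/
noncomputable def traceStep (w pbar : Fin S → ℝ) (st : State S) (b : Basis S) :
    Timed (State S) := do
  let wi ← readCell w b.i
  let wj ← readCell w b.j
  let bi ← readCell pbar b.i
  let bj ← readCell pbar b.j
  let pi ← readCell st.p b.i
  let pj ← readCell st.p b.j
  let fi ← between bi pi 1
  tick 1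
  if b.isC2 then
    let fj ← between bj pj 1
    if (← both fi fj) then
      if (← lt wj wi) then
        let W ← sub wi wj
        follow st b.slope W bj b.i b.j
      else
        let W ← sub wj wi
        follow st b.slope W bi b.j b.i
    else
      let points ← cons (st.ξ, st.q) st.points
      return ⟨st.ξ, st.q, st.p, points⟩
  else
    let fj ← between 0 pj bj
    if (← both fi fj) then
      let W ← add wi wj
      follow st b.slope W 0 b.i b.j
    else
      let points ← cons (st.ξ, st.q) st.points
      return ⟨st.ξ, st.q, st.p, points⟩

/-- The homotopy method. Its output is the array of the points `(ξ_t, q_t)`, `t = T, …, 0`, at which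
the function `q ξ = min {pᵀ z | p ∈ Δ, ‖p - pbar‖ ≤ ξ}` may have a breakpoint; `q` is constant
beyond `ξ_T`. -/
noncomputable def homotopy (z w pbar : Fin S → ℝ) : Timed (Array (ℝ × ℝ)) := do
  let p ← copy pbar
  let q ← forFin S (fun q i => do
    let pi ← readCell p i
    let zi ← readCell z i
    let x ← mul pi zi
    add q x) 0
  let points ← cons (0, q) []
  let D ← sortedBases z w
  let st ← forEach (traceStep w pbar) D ⟨0, q, p, points⟩
  store st.points

end HomotopyMethod

/-! ### The bisection method -/

namespace BisectionMethod

open Timed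

variable {A : ℕ}

/-- The inverse of the piecewise affine function `q` with the points `(ξ_t, q_t)`, `t = T, …, 0`, at
`u`: the least `ξ` with `q ξ ≤ u`, and `none` (that is, `∞`) if `u` is less than `q_T`. The segment
that contains `u` is found by binary search. -/
noncomputable def inverse (pts : Array (ℝ × ℝ)) (u : ℝ) : Timed (Option ℝ) := do
  tick 2
  let (_, qT) ← readAt pts 0 (0, 0)
  if (← lt u qT) then
    return none
  else
    let (_, q₀) ← readAt pts (pts.size - 1) (0, 0)
    if (← le q₀ u) then
      return some 0
    else
      let (lo, hi) ← bisect (fun k => do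
        let (_, qk) ← readAt pts k (0, 0)
        lt u qk) 0 (pts.size - 1)
      let (ξlo, qlo) ← readAt pts lo (0, 0)
      let (ξhi, qhi) ← readAt pts hi (0, 0)
      let a ← sub qhi u
      let b ← sub qhi qlo
      let t ← div a b
      let c ← sub ξlo ξhi
      let e ← mul t c
      let ξ ← add ξhi e
      return some ξ

/-- The budget `∑ a, q_a⁻¹ u`, where `none` stands for `∞`. -/
noncomputable def budget (pts : Fin A → Array (ℝ × ℝ)) (u : ℝ) : Timed (Option ℝ) :=
  forFin A (fun s a => do
    let l ← readCell pts a
    let x ← inverse l u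
    tick 1
    match s, x with
    | some s, some x => do
      let y ← add s x
      return some y
    | _, _ => return none) (some 0)

/-- Test whether a budget is at most `κ`. -/
noncomputable def isFeasible (s : Option ℝ) (κ : ℝ) : Timed Bool := do
  tick 1
  match s with
  | some s => le s κ
  | none => return false

/-- The values `q_t` of all actions as one list in ascending order, without duplicates. -/
noncomputable def combine (pts : Fin A → Array (ℝ × ℝ)) : Timed (Array ℝ) := do
  let K ← forFin A (fun K a => do
    let l ← readCell pts a
    forFin l.size (fun K k => do
      let (_, q) ← readAt l k (0, 0)
      cons q K) K) []
  let K ← mergeSort le K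
  let K ← dropDuplicates K
  store K

/-- The quasi-linear bisection method. It bisects the indices of the combined breakpoints, and then
solves a linear equation on the segment that is left. If the budget at its left end is infinite,
then the right end is optimal; if the left end is feasible, then it is itself optimal. -/
noncomputable def bisection (κ : ℝ) (pts : Fin A → Array (ℝ × ℝ)) : Timed ℝ := do
  let K ← combine pts
  tick 2
  let (kmin, kmax) ← bisect (fun k => do
    let u ← readAt K k 0
    let s ← budget pts u
    isFeasible s κ) 0 (K.size - 1)
  let umin ← readAt K kmin 0
  let umax ← readAt K kmax 0
  let smin ← budget pts umin
  let smax ← budget pts umax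
  tick 2
  match smin, smax with
  | some smin, some smax => do
    if (← le smin κ) then
      return umin
    else
      let a ← sub κ smin
      let b ← sub smax smin
      let α ← div a b
      let α' ← sub 1 α
      let x ← mul α' umin
      let y ← mul α umax
      add x y
  | _, _ => return umax

end BisectionMethod

namespace RMDP

open Timed

variable {S A : ℕ}

/-- The combined algorithm for the state `s`: for each action `a`, compute `z = r s a + γ v` and run
the homotopy method, and then run the bisection method on the results. -/
noncomputable def homotopyBisection (M : RMDP S A) (v : Fin S → ℝ) (s : Fin S) : Timed ℝ := do
  let pts ← alloc A (#[] : Array (ℝ × ℝ))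
  let pts ← forFin A (fun pts a => do
    let z ← alloc S (0 : ℝ)
    let z ← forFin S (fun z i => do
      let vi ← readCell v i
      let ri ← readCell (M.r s a) i
      let x ← mul M.γ vi
      let y ← add ri x
      writeCell z i y) z
    let l ← HomotopyMethod.homotopy z (M.w s a) (M.pbar s a)
    writeCell pts a l) pts
  BisectionMethod.bisection (M.κ s) pts

end RMDP

/-! ### Values and step counts of the program primitives. -/

namespace Timed

variable {α β σ : Type}

/-! For one action, let `q ξ` be the least value of `pᵀz` over distributions `p` within weighted
distance `ξ` of the nominal one. It is convex and piecewise affine, so it is determined by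
supporting lines, and the proof works with these lines only. Fix a slope `-l < 0`. A distribution
lies on the supporting line of that slope exactly when it minimizes the Lagrangian `pᵀz + l‖p -
pbar‖`, and for this it suffices that no transfer of mass between two states lowers the Lagrangian
(`HomotopyMethod.lagrangian_le`). A transfer along a basis changes `(ξ, q)` in the direction `(1,
slope)`, so with `l = -slope` it leaves the Lagrangian unchanged.

The tracing loop keeps an invariant (`TraceInv`): states already drained are empty, states already
used as donors of their excess have none left, and any state above its nominal value is an optimal
receiver for all slopes still to come. Because the bases are sorted, this makes the current `p` a
Lagrangian minimizer at the slope of the next basis, and following that basis stays on the same line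
(`traceStep_spec`). The tie-breaking rule is what prevents a state whose excess was removed from
receiving mass again at the same slope. Hence consecutive points span segments of the lower
envelope, and the last point minimizes `pᵀz` over the whole simplex (`trace_spec`).

Inverting a segment gives a least distance and a subgradient, exact up to the next breakpoint
(`IsInverse`). Summing over the actions, `u` is enforceable by the adversary for all actions at once
iff the total least distance is at most `κ`, and between neighbouring breakpoints this total is
affine in `u`. Bisection finds the interval and a linear equation finds the least enforceable `u`
(`isLeast_bisection`). That number is the Bellman value by a minimax argument: the set of attainable
vectors of action values is convex and misses the open orthant below `u`, and a separating
functional, normalized, is an optimal randomized action (`exists_le_sum_mul`, `robustBellman_eq`).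

For the cost, an action has at most `2S²` bases and hence at most `N = 2S² + 1` points. Sorting the
bases and the `AN` breakpoints gives the term `S²A log(SA)`; about `log(AN)` bisection tests, each
with `A` binary searches among at most `N` points, give the other one. -/

@[simp] theorem val_bind (m : Timed α) (f : α → Timed β) : (m >>= f).val = (f m.val).val := rfl

@[simp] theorem steps_bind (m : Timed α) (f : α → Timed β) :
    (m >>= f).steps = m.steps + (f m.val).steps := rfl

@[simp] theorem val_pure (x : α) : (pure x : Timed α).val = x := rfl
@[simp] theorem steps_pure (x : α) : (pure x : Timed α).steps = 0 := rfl
@[simp] theorem steps_tick (n : ℕ) : (tick n).steps = n := rfl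
@[simp] theorem val_add (x y : ℝ) : (add x y).val = x + y := rfl
@[simp] theorem val_sub (x y : ℝ) : (sub x y).val = x - y := rfl
@[simp] theorem val_mul (x y : ℝ) : (mul x y).val = x * y := rfl
@[simp] theorem val_div (x y : ℝ) : (div x y).val = x / y := rfl
@[simp] theorem val_le (x y : ℝ) : (le x y).val = decide (x ≤ y) := rfl
@[simp] theorem val_lt (x y : ℝ) : (lt x y).val = decide (x < y) := rfl
@[simp] theorem val_both (b c : Bool) : (both b c).val = (b && c) := rfl
@[simp] theorem val_cons (x : α) (l : List α) : (cons x l).val = x :: l := rfl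
@[simp] theorem val_alloc (n : ℕ) (x : α) : (alloc n x).val = fun _ => x := rfl
@[simp] theorem val_copy {n : ℕ} (f : Fin n → α) : (copy f).val = f := rfl
@[simp] theorem val_readCell {n : ℕ} (f : Fin n → α) (i : Fin n) : (readCell f i).val = f i := rfl
@[simp] theorem val_writeCell {n : ℕ} (f : Fin n → α) (i : Fin n) (x : α) :
    (writeCell f i x).val = Function.update f i x := rfl
@[simp] theorem val_store (l : List α) : (store l).val = l.toArray := rfl
@[simp] theorem val_readAt (l : Array α) (k : ℕ) (x : α) : (readAt l k x).val = l.getD k x := rfl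
@[simp] theorem steps_add (x y : ℝ) : (add x y).steps = 1 := rfl
@[simp] theorem steps_sub (x y : ℝ) : (sub x y).steps = 1 := rfl
@[simp] theorem steps_mul (x y : ℝ) : (mul x y).steps = 1 := rfl
@[simp] theorem steps_div (x y : ℝ) : (div x y).steps = 1 := rfl
@[simp] theorem steps_le (x y : ℝ) : (le x y).steps = 1 := rfl
@[simp] theorem steps_lt (x y : ℝ) : (lt x y).steps = 1 := rfl
@[simp] theorem steps_both (b c : Bool) : (both b c).steps = 1 := rfl
@[simp] theorem steps_cons (x : α) (l : List α) : (cons x l).steps = 1 := rfl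
@[simp] theorem steps_alloc (n : ℕ) (x : α) : (alloc n x).steps = n := rfl
@[simp] theorem steps_copy {n : ℕ} (f : Fin n → α) : (copy f).steps = n := rfl
@[simp] theorem steps_readCell {n : ℕ} (f : Fin n → α) (i : Fin n) :
    (readCell f i).steps = 1 := rfl
@[simp] theorem steps_writeCell {n : ℕ} (f : Fin n → α) (i : Fin n) (x : α) :
    (writeCell f i x).steps = 1 := rfl
@[simp] theorem steps_store (l : List α) : (store l).steps = l.length + 1 := rfl
@[simp] theorem steps_readAt (l : Array α) (k : ℕ) (x : α) : (readAt l k x).steps = 1 := rfl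

@[simp] theorem val_between (x y z : ℝ) :
    (between x y z).val = (decide (x ≤ y) && decide (y ≤ z)) := rfl
@[simp] theorem steps_between (x y z : ℝ) : (between x y z).steps = 3 := rfl

/-! ### Loops -/

@[simp] theorem val_forEach_nil (body : σ → α → Timed σ) (st : σ) :
    (forEach body [] st).val = st := rfl

@[simp] theorem val_forEach_cons (body : σ → α → Timed σ) (x : α) (l : List α) (st : σ) :
    (forEach body (x :: l) st).val = (forEach body l (body st x).val).val := rfl

theorem steps_forEach_le (body : σ → α → Timed σ) (l : List α) (st : σ) (P : σ → Prop) (m : ℕ)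
    (h₀ : P st) (hP : ∀ s x, P s → P (body s x).val) (hm : ∀ s x, P s → (body s x).steps ≤ m) :
    (forEach body l st).steps ≤ 1 + l.length * (1 + m) := by
  induction l generalizing st with
  | nil => simp [forEach]
  | cons x l ih =>
    have h1 := ih _ (hP st x h₀)
    have h2 := hm st x h₀
    simp only [forEach, steps_bind, steps_tick, List.length_cons]
    linarith

theorem steps_forFin_le {n : ℕ} (body : σ → Fin n → Timed σ) (st : σ) (m : ℕ)
    (hm : ∀ s x, (body s x).steps ≤ m) : (forFin n body st).steps ≤ 1 + n * (1 + m) := by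
  simpa [forFin] using steps_forEach_le body (List.finRange n) st (fun _ => True) m trivial
    (fun _ _ _ => trivial) (fun s x _ => hm s x)

theorem length_forEach_le (body : List β → α → Timed (List β)) (l : List α) (st : List β) (m : ℕ)
    (hm : ∀ s x, (body s x).val.length ≤ s.length + m) :
    (forEach body l st).val.length ≤ st.length + l.length * m := by
  induction l generalizing st with
  | nil => simp
  | cons x l ih =>
    have h1 := ih (body st x).val
    have h2 := hm st x
    simp only [val_forEach_cons, List.length_cons]
    linarith

theorem length_forFin_le {n : ℕ} (body : List β → Fin n → Timed (List β)) (st : List β) (m : ℕ)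
    (hm : ∀ s x, (body s x).val.length ≤ s.length + m) :
    (forFin n body st).val.length ≤ st.length + n * m := by
  simpa [forFin] using length_forEach_le body (List.finRange n) st m hm

/-- Membership in a list to which every iteration of a loop adds elements. -/
theorem mem_forEach_iff (body : List β → α → Timed (List β)) (Q : α → β → Prop)
    (h : ∀ s x b, b ∈ (body s x).val ↔ b ∈ s ∨ Q x b) (l : List α) (st : List β) (b : β) :
    b ∈ (forEach body l st).val ↔ b ∈ st ∨ ∃ x ∈ l, Q x b := by
  induction l generalizing st with
  | nil => simp
  | cons x l ih => simp [ih, h, or_assoc]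

theorem mem_forFin_iff {n : ℕ} (body : List β → Fin n → Timed (List β)) (Q : Fin n → β → Prop)
    (h : ∀ s x b, b ∈ (body s x).val ↔ b ∈ s ∨ Q x b) (st : List β) (b : β) :
    b ∈ (forFin n body st).val ↔ b ∈ st ∨ ∃ x, Q x b := by
  simp [forFin, mem_forEach_iff body Q h]

/-- A loop that writes one cell of an array in every iteration. -/
theorem val_forFin_writeCell {n : ℕ} (body : (Fin n → α) → Fin n → Timed (Fin n → α))
    (g : Fin n → α) (h : ∀ f i, (body f i).val = Function.update f i (g i)) (f : Fin n → α) :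
    (forFin n body f).val = g := by
  have key : ∀ (l : List (Fin n)) (f : Fin n → α) (i : Fin n),
      (forEach body l f).val i = if i ∈ l then g i else f i := by
    intro l
    induction l with
    | nil => simp
    | cons x l ih =>
      intro f i
      rw [val_forEach_cons, ih, h]
      by_cases hi : i ∈ l
      · simp [hi]
      · by_cases hx : i = x
        · subst hx; simp
        · simp [hi, hx]
  funext i
  simp [forFin, key]

theorem val_forFin_add {n : ℕ} (body : ℝ → Fin n → Timed ℝ) (g : Fin n → ℝ)
    (h : ∀ s i, (body s i).val = s + g i) (s : ℝ) : (forFin n body s).val = s + ∑ i, g i := by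
  have key : ∀ (l : List (Fin n)) (s : ℝ), (forEach body l s).val = s + (l.map g).sum := by
    intro l
    induction l with
    | nil => simp
    | cons x l ih => intro s; simp [ih, h, add_assoc]
  rw [forFin, key, ← List.ofFn_eq_map, List.sum_ofFn]

/-! ### Sorting -/

theorem perm_merge (cmp : α → α → Timed Bool) (k l : List α) :
    (merge cmp k l).val.Perm (k ++ l) := by
  fun_induction merge cmp k l with
  | case1 l => simp
  | case2 x k => simp
  | case3 x k y l ih₁ ih₂ =>
    simp only [val_bind]
    split_ifs
    · simpa using ih₁
    · simp only [val_bind, val_cons]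
      exact (ih₂.cons y).trans List.perm_middle.symm

theorem steps_merge_le (cmp : α → α → Timed Bool) (m : ℕ) (hm : ∀ x y, (cmp x y).steps ≤ m)
    (k l : List α) : (merge cmp k l).steps ≤ 1 + (k.length + l.length) * (m + 2) := by
  fun_induction merge cmp k l with
  | case1 l => simp
  | case2 x k => simp
  | case3 x k y l ih₁ ih₂ =>
    have := hm x y
    simp only [steps_bind, steps_tick]
    split_ifs <;> simp only [steps_bind, steps_cons, List.length_cons] at * <;> linarith

theorem pairwise_merge (cmp : α → α → Timed Bool) (R : α → α → Prop)
    (hR : ∀ x y z, R x y → R y z → R x z) (h₁ : ∀ x y, (cmp x y).val = true → R x y)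
    (h₂ : ∀ x y, (cmp x y).val ≠ true → R y x) (k l : List α) (hk : k.Pairwise R)
    (hl : l.Pairwise R) : (merge cmp k l).val.Pairwise R := by
  fun_induction merge cmp k l with
  | case1 l => simpa
  | case2 x k => simpa using hk
  | case3 x k y l ih₁ ih₂ =>
    rw [List.pairwise_cons] at hk hl
    simp only [val_bind]
    split_ifs with h
    · simp only [val_bind, val_cons, List.pairwise_cons]
      refine ⟨fun a ha => ?_, ih₁ hk.2 (List.pairwise_cons.2 hl)⟩
      have hxy := h₁ _ _ h
      rw [(perm_merge cmp _ _).mem_iff] at ha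
      simp only [List.mem_append, List.mem_cons] at ha
      rcases ha with ha | rfl | ha
      · exact hk.1 a ha
      · exact hxy
      · exact hR _ _ _ hxy (hl.1 a ha)
    · simp only [val_bind, val_cons, List.pairwise_cons]
      refine ⟨fun a ha => ?_, ih₂ (List.pairwise_cons.2 hk) hl.2⟩
      have hyx := h₂ _ _ h
      rw [(perm_merge cmp _ _).mem_iff] at ha
      simp only [List.mem_append, List.mem_cons] at ha
      rcases ha with (rfl | ha) | ha
      · exact hyx
      · exact hR _ _ _ hyx (hk.1 a ha)
      · exact hl.1 a ha

theorem perm_mergeSort (cmp : α → α → Timed Bool) (l : List α) :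
    (mergeSort cmp l).val.Perm l := by
  fun_induction mergeSort cmp l with
  | case1 l h => simp
  | case2 l h ih₁ ih₂ =>
    simp only [val_bind]
    refine (perm_merge _ _ _).trans ((ih₁.append ih₂).trans ?_)
    rw [List.take_append_drop]

theorem pairwise_mergeSort (cmp : α → α → Timed Bool) (R : α → α → Prop)
    (hR : ∀ x y z, R x y → R y z → R x z) (h₁ : ∀ x y, (cmp x y).val = true → R x y)
    (h₂ : ∀ x y, (cmp x y).val ≠ true → R y x) (l : List α) :
    (mergeSort cmp l).val.Pairwise R := by
  fun_induction mergeSort cmp l with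
  | case1 l h =>
    match l, h with
    | [], _ => simp
    | [x], _ => simp
  | case2 l h ih₁ ih₂ => exact pairwise_merge cmp R hR h₁ h₂ _ _ ih₁ ih₂

theorem clog_two_eq {n : ℕ} (hn : 2 ≤ n) : Nat.clog 2 n = Nat.clog 2 ((n + 1) / 2) + 1 := by
  rw [Nat.clog_of_two_le (by norm_num) hn]; rfl

/-- Each level of the recursion costs `2n` for splitting and at most `n(m + 2)` for merging. The
remaining `2n` in the factor `m + 6` absorbs the additive constants, since `n ≥ 2` whenever a split
occurs. Both halves have at most `(n + 1) / 2` elements, which matches the recurrence of `Nat.clog`.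
-/
theorem steps_mergeSort_le (cmp : α → α → Timed Bool) (m : ℕ) (hm : ∀ x y, (cmp x y).steps ≤ m)
    (l : List α) : (mergeSort cmp l).steps ≤ 1 + (m + 6) * l.length * Nat.clog 2 l.length := by
  fun_induction mergeSort cmp l with
  | case1 l h => simp
  | case2 l h ih₁ ih₂ =>
    have h3 := steps_merge_le cmp m hm (mergeSort cmp (l.take (l.length / 2))).val
      (mergeSort cmp (l.drop (l.length / 2))).val
    rw [(perm_mergeSort cmp _).length_eq, (perm_mergeSort cmp _).length_eq] at h3
    simp only [List.length_take, List.length_drop] at ih₁ ih₂ h3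
    simp only [steps_bind, steps_tick]
    rw [clog_two_eq (by omega : 2 ≤ l.length)]
    generalize l.length = n at *
    have e : min (n / 2) n = n / 2 := by omega
    rw [e] at ih₁ h3
    have c₁ : Nat.clog 2 (n / 2) ≤ Nat.clog 2 ((n + 1) / 2) := Nat.clog_mono_right 2 (by omega)
    have c₂ : Nat.clog 2 (n - n / 2) ≤ Nat.clog 2 ((n + 1) / 2) :=
      Nat.clog_mono_right 2 (by omega)
    have d₁ := Nat.mul_le_mul_left ((m + 6) * (n / 2)) c₁
    have d₂ := Nat.mul_le_mul_left ((m + 6) * (n - n / 2)) c₂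
    have e₂ : n / 2 + (n - n / 2) = n := by omega
    generalize Nat.clog 2 ((n + 1) / 2) = L at *
    have e₃ : (m + 6) * (n / 2) * L + (m + 6) * (n - n / 2) * L = (m + 6) * n * L := by
      rw [← add_mul, ← mul_add, e₂]
    rw [e₂] at h3
    have hn : 2 ≤ n := by omega
    nlinarith

/-- No monotonicity of the test is assumed. Each end of the final range is either an original end or
was placed there by the outcome of its own test, and this is all that the later arguments need. -/
theorem bisect_spec (test : ℕ → Timed Bool) (lo hi : ℕ) (h : lo ≤ hi) :
    lo ≤ (bisect test lo hi).val.1 ∧ (bisect test lo hi).val.1 ≤ (bisect test lo hi).val.2 ∧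
    (bisect test lo hi).val.2 ≤ hi ∧
    (bisect test lo hi).val.2 ≤ (bisect test lo hi).val.1 + 1 ∧
    (lo < hi → (bisect test lo hi).val.1 < (bisect test lo hi).val.2) ∧
    ((bisect test lo hi).val.1 = lo ∨ (test (bisect test lo hi).val.1).val = false) ∧
    ((bisect test lo hi).val.2 = hi ∨ (test (bisect test lo hi).val.2).val = true) := by
  fun_induction bisect test lo hi with
  | case1 lo hi h' => simp; omega
  | case2 lo hi h' ih₁ ih₂ =>
    simp only [val_bind]
    split_ifs with ht
    · obtain ⟨a, b, c, d, e, f, g⟩ := ih₁ (by omega)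
      refine ⟨a, b, by omega, d, fun _ => e (by omega), f, ?_⟩
      rcases g with g | g
      · right; rw [g]; exact ht
      · exact Or.inr g
    · obtain ⟨a, b, c, d, e, f, g⟩ := ih₂ (by omega)
      refine ⟨by omega, b, c, d, fun _ => e (by omega), ?_, g⟩
      rcases f with f | f
      · right; rw [f]; simpa using ht
      · exact Or.inr f

theorem steps_bisect_le (test : ℕ → Timed Bool) (m : ℕ) (hm : ∀ k, (test k).steps ≤ m)
    (lo hi : ℕ) : (bisect test lo hi).steps ≤ 2 + (5 + m) * Nat.clog 2 (hi - lo) := by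
  fun_induction bisect test lo hi with
  | case1 lo hi h => simp
  | case2 lo hi h ih₁ ih₂ =>
    have h1 := hm ((lo + hi + 1) / 2)
    simp only [steps_bind, steps_tick]
    rw [clog_two_eq (by omega : 2 ≤ hi - lo)]
    split_ifs
    · have c : Nat.clog 2 ((lo + hi + 1) / 2 - lo) ≤ Nat.clog 2 ((hi - lo + 1) / 2) :=
        Nat.clog_mono_right 2 (by omega)
      have := Nat.mul_le_mul_left (5 + m) c
      linarith
    · have c : Nat.clog 2 (hi - (lo + hi + 1) / 2) ≤ Nat.clog 2 ((hi - lo + 1) / 2) :=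
        Nat.clog_mono_right 2 (by omega)
      have := Nat.mul_le_mul_left (5 + m) c
      linarith

/-! ### Removal of duplicates -/

theorem mem_dropDuplicates (l : List ℝ) (hl : l.Pairwise (· ≤ ·)) (u : ℝ) :
    u ∈ (dropDuplicates l).val ↔ u ∈ l := by
  fun_induction dropDuplicates l with
  | case1 => simp
  | case2 x => simp
  | case3 x y l ih =>
    have ih := ih (List.pairwise_cons.1 hl).2
    have hxy : x ≤ y := (List.pairwise_cons.1 hl).1 y (by simp)
    by_cases h : x < y
    · simp [h, ih]
    · have : x = y := le_antisymm hxy (not_lt.1 h)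
      subst this
      simp [ih]

theorem pairwise_dropDuplicates (l : List ℝ) (hl : l.Pairwise (· ≤ ·)) :
    (dropDuplicates l).val.Pairwise (· < ·) := by
  fun_induction dropDuplicates l with
  | case1 => simp
  | case2 x => simp
  | case3 x y l ih =>
    rw [List.pairwise_cons] at hl
    have ih := ih hl.2
    by_cases h : x < y
    · simp only [val_bind, val_lt, h, decide_true, if_true, val_cons, List.pairwise_cons]
      refine ⟨fun a ha => ?_, ih⟩
      rw [mem_dropDuplicates _ hl.2, List.mem_cons] at ha
      rcases ha with rfl | ha
      · exact h
      · exact h.trans_le ((List.pairwise_cons.1 hl.2).1 a ha)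
    · simpa [h] using ih

theorem length_dropDuplicates_le (l : List ℝ) : (dropDuplicates l).val.length ≤ l.length := by
  fun_induction dropDuplicates l with
  | case1 => simp
  | case2 x => simp
  | case3 x y l ih =>
    simp only [val_bind]
    split_ifs <;> simp at * <;> omega

theorem steps_dropDuplicates_le (l : List ℝ) : (dropDuplicates l).steps ≤ 1 + 3 * l.length := by
  fun_induction dropDuplicates l with
  | case1 => simp
  | case2 x => simp
  | case3 x y l ih =>
    simp only [steps_bind]
    split_ifs <;> simp at * <;> omega

end Timed

namespace HomotopyMethod

open Timed

variable {S : ℕ}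

/-! ### Optimality conditions for the Lagrangian -/

/-- A point `p` of the simplex from which no transfer of probability improves the Lagrangian
minimizes it. -/
theorem lagrangian_le {z w pbar p p' : Fin S → ℝ} {l : ℝ} (hl : 0 ≤ l) (hw : ∀ i, 0 < w i)
    (hp : p ∈ stdSimplex ℝ (Fin S)) (hp' : p' ∈ stdSimplex ℝ (Fin S))
    (surplus : ∀ j, pbar j < p j → ∀ i, z j + l * w j ≤ z i + l * w i)
    (deficit : ∀ j, p j < pbar j → ∃ i, z i + l * w i ≤ z j - l * w j)
    (support : ∀ j, 0 < p j → ∀ i, z j - l * w j ≤ z i + l * w i) :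
    ∑ i, p i * z i + l * weightedL1 w (p - pbar) ≤
      ∑ i, p' i * z i + l * weightedL1 w (p' - pbar) := by
  have hne : Nonempty (Fin S) := by
    by_contra h
    rw [not_nonempty_iff] at h
    have := hp.2
    simp at this
  obtain ⟨k, hk⟩ := Finite.exists_min (fun i => z i + l * w i)
  set ρ := z k + l * w k with hρ
  -- Below the nominal value the derivative vanishes or `p i` sits at `0` with nonnegative
  -- derivative; at the nominal value `0` is a subgradient; above it the derivative vanishes.
  have key : ∀ i, (z i - ρ) * p i + l * w i * |p i - pbar i| ≤
      (z i - ρ) * p' i + l * w i * |p' i - pbar i| := by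
    intro i
    have hm : 0 ≤ l * w i := mul_nonneg hl (hw i).le
    have h0 : 0 ≤ p i := hp.1 i
    have h0' : 0 ≤ p' i := hp'.1 i
    have a₁ := mul_le_mul_of_nonneg_left (le_abs_self (p' i - pbar i)) hm
    have a₂ := mul_le_mul_of_nonneg_left (neg_abs_le (p' i - pbar i)) hm
    have hki : ρ ≤ z i + l * w i := hk i
    have hs : 0 < p i → z i - l * w i ≤ ρ := fun h => support i h k
    rcases lt_trichotomy (p i) (pbar i) with h | h | h
    · obtain ⟨j, hj⟩ := deficit i h
      have hj' : ρ ≤ z i - l * w i := (hk j).trans hj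
      rw [abs_of_neg (sub_neg.2 h)]
      rcases h0.eq_or_lt with h1 | h1
      · rw [← h1]
        nlinarith
      · have : z i - ρ = l * w i := by linarith [hs h1]
        rw [this]
        nlinarith
    · rw [← h, sub_self, abs_zero, mul_zero, add_zero]
      rw [← h] at a₁ a₂
      rcases le_total (p i) (p' i) with h2 | h2
      · nlinarith
      · rcases h0.eq_or_lt with h1 | h1
        · have : p' i = p i := by linarith
          rw [this]; simp
        · nlinarith [hs h1]
    · have : z i - ρ = -(l * w i) := by linarith [surplus i h k]
      rw [abs_of_pos (sub_pos.2 h), this]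
      nlinarith
  have hsum := Finset.sum_le_sum (fun i (_ : i ∈ Finset.univ) => key i)
  have e : ∀ q : Fin S → ℝ, q ∈ stdSimplex ℝ (Fin S) →
      ∑ i, ((z i - ρ) * q i + l * w i * |q i - pbar i|) =
        ∑ i, q i * z i + l * weightedL1 w (q - pbar) - ρ := by
    intro q hq
    have : ρ = ∑ i, ρ * q i := by rw [← Finset.mul_sum, hq.2, mul_one]
    rw [weightedL1, Finset.mul_sum]
    conv_rhs => rw [this]
    rw [← Finset.sum_add_distrib, ← Finset.sum_sub_distrib]
    refine Finset.sum_congr rfl fun i _ => ?_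
    simp only [Pi.sub_apply]
    ring
  rw [e p hp, e p' hp'] at hsum
  linarith

/-! ### Transfers of probability -/

/-- Move the amount `δ` from `d` to `r`. -/
def transfer (p : Fin S → ℝ) (r d : Fin S) (δ : ℝ) : Fin S → ℝ :=
  Function.update (Function.update p r (p r + δ)) d (p d - δ)

theorem transfer_donor (p : Fin S → ℝ) (r d : Fin S) (δ : ℝ) : transfer p r d δ d = p d - δ := by
  simp [transfer]

theorem transfer_receiver (p : Fin S → ℝ) {r d : Fin S} (h : r ≠ d) (δ : ℝ) :
    transfer p r d δ r = p r + δ := by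
  simp [transfer, h]

theorem transfer_other (p : Fin S → ℝ) {r d i : Fin S} (hr : i ≠ r) (hd : i ≠ d) (δ : ℝ) :
    transfer p r d δ i = p i := by
  simp [transfer, hr, hd]

theorem transfer_zero (p : Fin S → ℝ) {r d : Fin S} : transfer p r d 0 = p := by
  simp [transfer]

theorem sum_transfer (p : Fin S → ℝ) {r d : Fin S} (h : r ≠ d) (δ : ℝ) (f : Fin S → ℝ → ℝ) :
    ∑ i, f i (transfer p r d δ i) =
      ∑ i, f i (p i) + (f r (p r + δ) - f r (p r)) + (f d (p d - δ) - f d (p d)) := by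
  have : ∑ i, (f i (transfer p r d δ i) - f i (p i)) =
      (f r (p r + δ) - f r (p r)) + (f d (p d - δ) - f d (p d)) := by
    rw [Finset.sum_eq_add r d h]
    · rw [transfer_donor, transfer_receiver p h]
    · intro i _ hi
      rw [transfer_other p hi.1 hi.2, sub_self]
    · simp
    · simp
  rw [Finset.sum_sub_distrib] at this
  linarith

theorem transfer_mem_stdSimplex {p : Fin S → ℝ} (hp : p ∈ stdSimplex ℝ (Fin S)) {r d : Fin S}
    (h : r ≠ d) {δ : ℝ} (h₀ : 0 ≤ δ) (h₁ : δ ≤ p d) :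
    transfer p r d δ ∈ stdSimplex ℝ (Fin S) := by
  refine ⟨fun i => ?_, ?_⟩
  · by_cases hd : i = d
    · subst hd; rw [transfer_donor]; linarith
    · by_cases hr : i = r
      · subst hr; rw [transfer_receiver p h]; linarith [hp.1 i]
      · rw [transfer_other p hr hd]; exact hp.1 i
  · rw [sum_transfer p h δ (fun _ x => x), hp.2]; ring

/-! ### Bases -/

/-- `b` is a basis of class (C1) with receiver `r` and donor `d`. -/
structure Basis.IsDrain (z w : Fin S → ℝ) (b : Basis S) (r d : Fin S) : Prop where
  isC2 : b.isC2 = false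
  hi : b.i = r
  hj : b.j = d
  tie : b.tie = 0
  slope : z r - z d = b.slope * (w r + w d)

/-- `b` is a basis of class (C2) with receiver `r` and donor `d`. -/
structure Basis.IsShift (z w : Fin S → ℝ) (b : Basis S) (r d : Fin S) : Prop where
  isC2 : b.isC2 = true
  lt : w d < w r
  hij : b.i = r ∧ b.j = d ∨ b.i = d ∧ b.j = r
  tie : b.tie = w d
  slope : z r - z d = b.slope * (w r - w d)

/-- The order in which the bases are sorted. -/
def Basis.Le (b c : Basis S) : Prop := b.slope < c.slope ∨ b.slope = c.slope ∧ b.tie ≤ c.tie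

theorem Basis.Le.slope_le {b c : Basis S} (h : b.Le c) : b.slope ≤ c.slope := by
  rcases h with h | h
  · exact h.le
  · exact h.1.le

theorem Basis.IsDrain.ne {z w : Fin S → ℝ} {b : Basis S} {r d : Fin S} (h : b.IsDrain z w r d)
    (hw : ∀ i, 0 < w i) (hb : b.slope < 0) : r ≠ d := by
  rintro rfl
  have := h.slope
  nlinarith [hw r]

theorem Basis.IsShift.ne {z w : Fin S → ℝ} {b : Basis S} {r d : Fin S}
    (h : b.IsShift z w r d) : r ≠ d := by
  rintro rfl
  exact lt_irrefl _ h.lt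

/-- A sorted list of all bases with negative slopes. -/
structure IsBasisList (z w : Fin S → ℝ) (D : List (Basis S)) : Prop where
  sorted : D.Pairwise Basis.Le
  slope_neg : ∀ b ∈ D, b.slope < 0
  cases : ∀ b ∈ D, ∃ r d, b.IsDrain z w r d ∨ b.IsShift z w r d
  drain : ∀ r d, z r < z d → ∃ b ∈ D, b.IsDrain z w r d
  shift : ∀ r d, z r < z d → w d < w r → ∃ b ∈ D, b.IsShift z w r d

theorem mem_addBases (z w : Fin S → ℝ) (D : List (Basis S)) (i j : Fin S) (b : Basis S) :
    b ∈ (addBases z w D i j).val ↔ b ∈ D ∨ (i ≠ j ∧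
      (b = ⟨(z i - z j) / (w i + w j), 0, false, i, j⟩ ∧ (z i - z j) / (w i + w j) < 0 ∨
      b = ⟨(z i - z j) / (w i - w j), w j, true, i, j⟩ ∧ w j < w i ∧
        (z i - z j) / (w i - w j) < 0 ∨
      b = ⟨(z i - z j) / (w i - w j), w i, true, i, j⟩ ∧ w i < w j ∧
        (z i - z j) / (w i - w j) < 0)) := by
  simp only [addBases, val_bind]
  by_cases h : i = j
  · simp [h]
  · rcases lt_trichotomy (w i) (w j) with hw | hw | hw
    · by_cases h1 : (z i - z j) / (w i + w j) < 0 <;>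
      by_cases h2 : (z i - z j) / (w i - w j) < 0 <;>
      simp [h, h1, h2, hw, not_lt.2 hw.le] <;> tauto
    · have hlt : ¬w i < w j := hw.not_lt
      have hgt : ¬w j < w i := hw.not_gt
      by_cases h1 : (z i - z j) / (w i + w j) < 0 <;>
      simp [h, h1, hlt, hgt] <;> tauto
    · by_cases h1 : (z i - z j) / (w i + w j) < 0 <;>
      by_cases h2 : (z i - z j) / (w i - w j) < 0 <;>
      simp [h, h1, h2, hw, not_lt.2 hw.le] <;> tauto

theorem mem_sortedBases (z w : Fin S → ℝ) (b : Basis S) :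
    b ∈ (sortedBases z w).val ↔ ∃ i j : Fin S, i ≠ j ∧
      (b = ⟨(z i - z j) / (w i + w j), 0, false, i, j⟩ ∧ (z i - z j) / (w i + w j) < 0 ∨
      b = ⟨(z i - z j) / (w i - w j), w j, true, i, j⟩ ∧ w j < w i ∧
        (z i - z j) / (w i - w j) < 0 ∨
      b = ⟨(z i - z j) / (w i - w j), w i, true, i, j⟩ ∧ w i < w j ∧
        (z i - z j) / (w i - w j) < 0) := by
  simp only [sortedBases, val_bind]
  rw [(perm_mergeSort _ _).mem_iff,
    mem_forFin_iff _ _ (fun D i b =>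
      mem_forFin_iff _ _ (fun D j b => mem_addBases z w D i j b) D b)]
  simp

theorem isBasisList_sortedBases (z w : Fin S → ℝ) (hw : ∀ i, 0 < w i) :
    IsBasisList z w (sortedBases z w).val where
  sorted := by
    simp only [sortedBases, val_bind]
    refine pairwise_mergeSort _ _ ?_ ?_ ?_ _
    · rintro x y c (h | h) (h' | h')
      · exact Or.inl (h.trans h')
      · exact Or.inl (h'.1 ▸ h)
      · exact Or.inl (h.1 ▸ h')
      · exact Or.inr ⟨h.1.trans h'.1, h.2.trans h'.2⟩
    · intro x y h
      rcases lt_trichotomy x.slope y.slope with h1 | h1 | h1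
      · exact Or.inl h1
      · simp [Basis.cmp, h1] at h
        exact Or.inr ⟨h1, h⟩
      · simp [Basis.cmp, h1, not_lt.2 h1.le] at h
    · intro x y h
      rcases lt_trichotomy x.slope y.slope with h1 | h1 | h1
      · simp [Basis.cmp, h1] at h
      · simp [Basis.cmp, h1] at h
        exact Or.inr ⟨h1.symm, h.le⟩
      · exact Or.inl h1
  slope_neg := by
    intro b hb
    obtain ⟨i, j, -, ⟨rfl, h⟩ | ⟨rfl, -, h⟩ | ⟨rfl, -, h⟩⟩ := (mem_sortedBases z w b).1 hb <;>
      exact h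
  cases := by
    intro b hb
    obtain ⟨i, j, -, ⟨rfl, h⟩ | ⟨rfl, h, -⟩ | ⟨rfl, h, -⟩⟩ := (mem_sortedBases z w b).1 hb
    · have := add_pos (hw i) (hw j)
      exact ⟨i, j, Or.inl ⟨rfl, rfl, rfl, rfl, (div_mul_cancel₀ _ this.ne').symm⟩⟩
    · have := sub_pos.2 h
      exact ⟨i, j, Or.inr ⟨rfl, h, Or.inl ⟨rfl, rfl⟩, rfl, (div_mul_cancel₀ _ this.ne').symm⟩⟩
    · have := sub_neg.2 h
      refine ⟨j, i, Or.inr ⟨rfl, h, Or.inr ⟨rfl, rfl⟩, rfl, ?_⟩⟩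
      have e := div_mul_cancel₀ (z i - z j) this.ne
      dsimp only
      linarith
  drain := by
    intro r d h
    have := add_pos (hw r) (hw d)
    refine ⟨⟨(z r - z d) / (w r + w d), 0, false, r, d⟩, (mem_sortedBases z w _).2
      ⟨r, d, ?_, Or.inl ⟨rfl, div_neg_of_neg_of_pos (sub_neg.2 h) this⟩⟩,
      ⟨rfl, rfl, rfl, rfl, (div_mul_cancel₀ _ this.ne').symm⟩⟩
    rintro rfl
    exact lt_irrefl _ h
  shift := by
    intro r d h hwd
    have := sub_pos.2 hwd
    refine ⟨⟨(z r - z d) / (w r - w d), w d, true, r, d⟩, (mem_sortedBases z w _).2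
      ⟨r, d, ?_, Or.inr (Or.inl ⟨rfl, hwd, div_neg_of_neg_of_pos (sub_neg.2 h) this⟩)⟩,
      ⟨rfl, hwd, Or.inl ⟨rfl, rfl⟩, rfl, (div_mul_cancel₀ _ this.ne').symm⟩⟩
    rintro rfl
    exact lt_irrefl _ h

/-! ### The invariant of the tracing loop -/

/-- The invariant of the tracing loop, where `pre` are the bases processed so far and `suf` are the
remaining ones. -/
structure TraceInv (z w pbar : Fin S → ℝ) (pre suf : List (Basis S)) (p : Fin S → ℝ) : Prop where
  mem : p ∈ stdSimplex ℝ (Fin S)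
  drained : ∀ b ∈ pre, ∀ r d, b.IsDrain z w r d → p d = 0
  shifted : ∀ b ∈ pre, ∀ r d, b.IsShift z w r d → p d ≤ pbar d
  deficit : ∀ d, p d < pbar d → ∃ b ∈ pre, ∃ r, b.IsDrain z w r d
  surplus : ∀ j, pbar j < p j → ∀ i, w i ≤ w j → ∀ b ∈ suf, z j - z i ≤ b.slope * (w j - w i)

section

variable {z w pbar : Fin S → ℝ} {pre suf : List (Basis S)} {b : Basis S} {p : Fin S → ℝ}

theorem IsBasisList.le_of_mem_pre (hD : IsBasisList z w (pre ++ b :: suf)) {c : Basis S}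
    (hc : c ∈ pre) : c.Le b :=
  (List.pairwise_append.1 hD.sorted).2.2 c hc b (by simp)

theorem IsBasisList.le_of_mem_suf (hD : IsBasisList z w (pre ++ b :: suf)) {c : Basis S}
    (hc : c ∈ suf) : b.Le c :=
  (List.pairwise_cons.1 (List.pairwise_append.1 hD.sorted).2.1).1 c hc

theorem IsBasisList.mem_pre (hD : IsBasisList z w (pre ++ b :: suf)) {c : Basis S}
    (hc : c ∈ pre ++ b :: suf) (h : c.slope < b.slope) : c ∈ pre := by
  rw [List.mem_append, List.mem_cons] at hc
  rcases hc with hc | rfl | hc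
  · exact hc
  · exact absurd h (lt_irrefl _)
  · exact absurd ((hD.le_of_mem_suf hc).slope_le) (not_le.2 h)

theorem IsBasisList.slope_neg_head (hD : IsBasisList z w (pre ++ b :: suf)) : b.slope < 0 :=
  hD.slope_neg b (by simp)

/-- The hypothesis says that the slope of the pair is strictly below that of `b`, so sorting alone
places its basis before `b`, whatever the ties. -/
theorem IsBasisList.exists_drain (hD : IsBasisList z w (pre ++ b :: suf)) (hw : ∀ i, 0 < w i)
    {i j : Fin S} (h : z i - z j < b.slope * (w i + w j)) : ∃ c ∈ pre, c.IsDrain z w i j := by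
  have hb := hD.slope_neg_head
  have hs := add_pos (hw i) (hw j)
  obtain ⟨c, hc, hcd⟩ := hD.drain i j (by nlinarith)
  refine ⟨c, hD.mem_pre hc ?_, hcd⟩
  rw [hcd.slope] at h
  exact lt_of_mul_lt_mul_right h hs.le

theorem IsBasisList.exists_shift (hD : IsBasisList z w (pre ++ b :: suf))
    {i j : Fin S} (hij : w j < w i) (h : z i - z j < b.slope * (w i - w j)) :
    ∃ c ∈ pre, c.IsShift z w i j := by
  have hb := hD.slope_neg_head
  have hs := sub_pos.2 hij
  obtain ⟨c, hc, hcd⟩ := hD.shift i j (by nlinarith) hij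
  refine ⟨c, hD.mem_pre hc ?_, hcd⟩
  rw [hcd.slope] at h
  exact lt_of_mul_lt_mul_right h hs.le

namespace TraceInv

theorem eq_zero (h : TraceInv z w pbar pre (b :: suf) p)
    (hD : IsBasisList z w (pre ++ b :: suf)) (hw : ∀ i, 0 < w i) {i j : Fin S}
    (hij : z i - z j < b.slope * (w i + w j)) : p j = 0 := by
  obtain ⟨c, hc, hcd⟩ := hD.exists_drain hw hij
  exact h.drained c hc i j hcd

/-- Against lighter states this is part of the invariant. A heavier `i` that undercuts `j` would
give a C2 basis with donor `j` of smaller slope; that basis has been processed, so `j` could have no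
excess left. -/
theorem surplus_le (h : TraceInv z w pbar pre (b :: suf) p)
    (hD : IsBasisList z w (pre ++ b :: suf)) {j : Fin S} (hj : pbar j < p j) (i : Fin S) :
    z j - z i ≤ b.slope * (w j - w i) := by
  rcases le_or_gt (w i) (w j) with hij | hij
  · exact h.surplus j hj i hij b (by simp)
  · by_contra hlt
    obtain ⟨c, hc, hcd⟩ := hD.exists_shift hij (by linarith : z i - z j < b.slope * (w i - w j))
    exact absurd (h.shifted c hc i j hcd) (not_le.2 hj)

/-- Mass falls below nominal only through a C1 basis. Its slope is at most that of `b`, so its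
receiver witnesses the inequality. -/
theorem deficit_le (h : TraceInv z w pbar pre (b :: suf) p)
    (hD : IsBasisList z w (pre ++ b :: suf)) (hw : ∀ i, 0 < w i) {j : Fin S} (hj : p j < pbar j) :
    ∃ i, z i - z j ≤ b.slope * (w i + w j) := by
  obtain ⟨c, hc, i, hcd⟩ := h.deficit j hj
  refine ⟨i, ?_⟩
  rw [hcd.slope]
  exact mul_le_mul_of_nonneg_right (hD.le_of_mem_pre hc).slope_le (add_pos (hw i) (hw j)).le

theorem lagrangian_le (h : TraceInv z w pbar pre (b :: suf) p)
    (hD : IsBasisList z w (pre ++ b :: suf)) (hw : ∀ i, 0 < w i) {p' : Fin S → ℝ}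
    (hp' : p' ∈ stdSimplex ℝ (Fin S)) :
    ∑ i, p i * z i + -b.slope * weightedL1 w (p - pbar) ≤
      ∑ i, p' i * z i + -b.slope * weightedL1 w (p' - pbar) := by
  -- The multiplier is `l = -b.slope`; the three goals are the surplus, deficit and support
  -- conditions at that multiplier.
  refine HomotopyMethod.lagrangian_le (neg_nonneg.2 hD.slope_neg_head.le) hw h.mem hp' ?_ ?_ ?_
  · intro j hj i
    linarith [h.surplus_le hD hj i]
  · intro j hj
    obtain ⟨i, hi⟩ := h.deficit_le hD hw hj
    exact ⟨i, by linarith⟩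
  · intro j hj i
    by_contra hlt
    exact hj.ne' (h.eq_zero hD hw (i := i) (by linarith))

/-- If `r` is optimal among the receivers, then it has not been a donor. -/
theorem not_drained (hD : IsBasisList z w (pre ++ b :: suf)) (hw : ∀ i, 0 < w i) {r : Fin S}
    (hr : ∀ k, z r - z k ≤ b.slope * (w r - w k)) {c : Basis S} (hc : c ∈ pre) {k : Fin S}
    (hcd : c.IsDrain z w k r) : False := by
  have h1 := mul_le_mul_of_nonneg_right (hD.le_of_mem_pre hc).slope_le
    (add_pos (hw k) (hw r)).le
  have := hcd.slope
  nlinarith [hr k, hw r, hD.slope_neg_head]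

/-- Here the tie-breaking matters. Optimality of `r` as a receiver forces an earlier C2 basis with
donor `r` to have exactly the slope of `b`; its tie value is then `w r`, and sorting gives `w r ≤
b.tie`, a contradiction. The condition `b.tie < w r` holds for C1, where the tie is `0`, and for C2,
where it is the weight of the lighter donor. -/
theorem not_shifted (hD : IsBasisList z w (pre ++ b :: suf)) {r : Fin S}
    (hr : ∀ k, z r - z k ≤ b.slope * (w r - w k)) (htie : b.tie < w r) {c : Basis S}
    (hc : c ∈ pre) {k : Fin S} (hcd : c.IsShift z w k r) : False := by
  have hs := sub_pos.2 hcd.lt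
  have hle : b.slope ≤ c.slope := by
    refine le_of_mul_le_mul_right ?_ hs
    rw [← hcd.slope]
    linarith [hr k]
  rcases hD.le_of_mem_pre hc with h | h
  · linarith
  · have := h.2
    rw [hcd.tie] at this
    linarith

theorem nominal_le (h : TraceInv z w pbar pre (b :: suf) p)
    (hD : IsBasisList z w (pre ++ b :: suf)) (hw : ∀ i, 0 < w i) {r : Fin S}
    (hr : ∀ k, z r - z k ≤ b.slope * (w r - w k)) : pbar r ≤ p r := by
  by_contra hlt
  obtain ⟨c, hc, k, hcd⟩ := h.deficit r (not_le.1 hlt)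
  exact not_drained hD hw hr hc hcd

/-- One argument for both classes. The receiver has never been a donor, so earlier drains and shifts
are not undone. A new deficit comes only from a drain. A new surplus can arise only at `r`, which is
an optimal receiver at the slope of `b`; against lighter states that inequality persists, because
slopes only increase. Optimality is required only for `0 < δ`, since skipped bases are treated as
transfers of `0`. -/
theorem step (h : TraceInv z w pbar pre (b :: suf) p) (hD : IsBasisList z w (pre ++ b :: suf))
    (hw : ∀ i, 0 < w i) {r d : Fin S} (hrd : r ≠ d) {δ : ℝ} (h₀ : 0 ≤ δ) (h₁ : δ ≤ p d)
    (htie : b.tie < w r) (hr : 0 < δ → ∀ k, z r - z k ≤ b.slope * (w r - w k))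
    (hdrain : ∀ r' d', b.IsDrain z w r' d' → d' = d ∧ δ = p d)
    (hshift : ∀ r' d', b.IsShift z w r' d' → d' = d ∧ p d - δ ≤ pbar d)
    (hdef : p d - δ < pbar d → p d < pbar d ∨ b.IsDrain z w r d) :
    TraceInv z w pbar (pre ++ [b]) suf (transfer p r d δ) where
  mem := transfer_mem_stdSimplex h.mem hrd h₀ h₁
  drained := by
    intro c hc r' d' hcd
    rw [List.mem_append, List.mem_singleton] at hc
    rcases hc with hc | rfl
    · have e := h.drained c hc r' d' hcd
      by_cases hd : d' = d
      · subst hd; rw [transfer_donor]; linarith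
      · by_cases hr' : d' = r
        · subst hr'
          rw [transfer_receiver p hrd, e, zero_add]
          by_contra hδ
          exact not_drained hD hw (hr (lt_of_le_of_ne h₀ (Ne.symm hδ))) hc hcd
        · rw [transfer_other p hr' hd, e]
    · obtain ⟨rfl, rfl⟩ := hdrain r' d' hcd
      rw [transfer_donor, sub_self]
  shifted := by
    intro c hc r' d' hcd
    rw [List.mem_append, List.mem_singleton] at hc
    rcases hc with hc | rfl
    · have e := h.shifted c hc r' d' hcd
      by_cases hd : d' = d
      · subst hd; rw [transfer_donor]; linarith
      · by_cases hr' : d' = r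
        · subst hr'
          rw [transfer_receiver p hrd]
          rcases h₀.eq_or_lt with hδ | hδ
          · linarith
          · exact (not_shifted hD (hr hδ) htie hc hcd).elim
        · rwa [transfer_other p hr' hd]
    · obtain ⟨rfl, hle⟩ := hshift r' d' hcd
      rwa [transfer_donor]
  deficit := by
    intro j hj
    have key : p j < pbar j ∨ ∃ r, b.IsDrain z w r j := by
      by_cases hd : j = d
      · subst hd
        rw [transfer_donor] at hj
        exact (hdef hj).imp id fun h => ⟨r, h⟩
      · by_cases hr' : j = r
        · subst hr'
          rw [transfer_receiver p hrd] at hj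
          left; linarith
        · rw [transfer_other p hr' hd] at hj
          exact Or.inl hj
    rcases key with hj | ⟨r', hj⟩
    · obtain ⟨c, hc, k, hcd⟩ := h.deficit j hj
      exact ⟨c, by simp [hc], k, hcd⟩
    · exact ⟨b, by simp, r', hj⟩
  surplus := by
    intro j hj i hij c hc
    by_cases hp : pbar j < p j
    · exact h.surplus j hp i hij c (by simp [hc])
    · have hδ : 0 < δ ∧ j = r := by
        by_cases hd : j = d
        · subst hd
          rw [transfer_donor] at hj
          exfalso; linarith
        · by_cases hr' : j = r
          · refine ⟨?_, hr'⟩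
            subst hr'
            rw [transfer_receiver p hrd] at hj
            linarith
          · rw [transfer_other p hr' hd] at hj
            exact absurd hj hp
      obtain ⟨hδ, rfl⟩ := hδ
      exact (hr hδ i).trans (mul_le_mul_of_nonneg_right (hD.le_of_mem_suf hc).slope_le
        (sub_nonneg.2 hij))

/-- At the end of the loop, `p` minimizes the objective over the simplex. -/
theorem sum_mul_le {D : List (Basis S)} (h : TraceInv z w pbar D [] p)
    (hD : IsBasisList z w D) {p' : Fin S → ℝ} (hp' : p' ∈ stdSimplex ℝ (Fin S)) :
    ∑ i, p i * z i ≤ ∑ i, p' i * z i := by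
  have hne : Nonempty (Fin S) := by
    by_contra hn
    rw [not_nonempty_iff] at hn
    have := hp'.2
    simp at this
  obtain ⟨k, hk⟩ := Finite.exists_min z
  have e₁ : ∑ i, p i * z i ≤ ∑ i, p i * z k := by
    -- A state that is not a minimizer of `z` is the donor of a C1 basis with receiver `k`, hence
    -- empty at the end.
    refine Finset.sum_le_sum fun i _ => ?_
    by_cases hi : z k < z i
    · obtain ⟨b, hb, hbd⟩ := hD.drain k i hi
      rw [h.drained b hb k i hbd]; simp
    · exact mul_le_mul_of_nonneg_left (not_lt.1 hi) (h.mem.1 i)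
  have e₂ : ∑ i, p' i * z k ≤ ∑ i, p' i * z i :=
    Finset.sum_le_sum fun i _ => mul_le_mul_of_nonneg_left (hk i) (hp'.1 i)
  rw [← Finset.sum_mul, h.mem.2] at e₁
  rw [← Finset.sum_mul, hp'.2] at e₂
  linarith

end TraceInv

end

end HomotopyMethod

/-! ### One iteration of the tracing loop. -/

namespace HomotopyMethod

open Timed

variable {S : ℕ}

/-- The state after a transfer of `δ` from `d` to `r` along a basis of the given slope. -/
def State.moved (st : State S) (slope W : ℝ) (r d : Fin S) (δ : ℝ) : State S :=
  ⟨st.ξ + δ * W, st.q + δ * W * slope, transfer st.p r d δ,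
    (st.ξ + δ * W, st.q + δ * W * slope) :: st.points⟩

theorem val_follow (st : State S) (slope floor : ℝ) {W : ℝ} (hW : 0 < W) (r d : Fin S) :
    (follow st slope W floor r d).val = st.moved slope W r d (st.p d - floor) := by
  have e : (st.p d - floor) * W * W⁻¹ = st.p d - floor := by field_simp
  simp [follow, State.moved, transfer, e]

theorem moved_zero (st : State S) (slope W : ℝ) (r d : Fin S) :
    st.moved slope W r d 0 = ⟨st.ξ, st.q, st.p, (st.ξ, st.q) :: st.points⟩ := by
  simp [State.moved, transfer_zero]

/-- Under the hypothesis, the feasibility test can fail only if the donor is already empty, and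
skipping the basis then agrees with moving nothing. -/
theorem val_traceStep_drain {z w pbar : Fin S → ℝ} {st : State S} {b : Basis S} {r d : Fin S}
    (hw : ∀ i, 0 < w i) (hb : b.IsDrain z w r d)
    (h : pbar r ≤ st.p r ∧ st.p r ≤ 1 ∧ 0 ≤ st.p d ∧ st.p d ≤ pbar d ∨ st.p d = 0) :
    (traceStep w pbar st b).val = st.moved b.slope (w r + w d) r d (st.p d) := by
  obtain ⟨h1, rfl, rfl, -, -⟩ := hb
  by_cases hc : (pbar b.i ≤ st.p b.i ∧ st.p b.i ≤ 1) ∧ 0 ≤ st.p b.j ∧ st.p b.j ≤ pbar b.j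
  · simp [traceStep, h1, hc, val_follow st b.slope 0 (add_pos (hw b.i) (hw b.j))]
  · have h0 : st.p b.j = 0 := h.resolve_left (by tauto)
    rw [h0, moved_zero]
    have hc' : ¬((pbar b.i ≤ st.p b.i ∧ st.p b.i ≤ 1) ∧ 0 ≤ pbar b.j) := by
      simpa [h0] using hc
    simp [traceStep, h1, h0, hc']

/-- The basis is skipped only if the donor has no excess; the maximum with `0` covers this case as a
transfer of nothing. -/
theorem val_traceStep_shift {z w pbar : Fin S → ℝ} {st : State S} {b : Basis S} {r d : Fin S}
    (hb : b.IsShift z w r d) (hp : ∀ i, st.p i ≤ 1)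
    (h : pbar r ≤ st.p r ∨ st.p d ≤ pbar d) :
    (traceStep w pbar st b).val =
      st.moved b.slope (w r - w d) r d (max (st.p d - pbar d) 0) := by
  obtain ⟨h1, hlt, hij, -, -⟩ := hb
  by_cases hc : pbar r ≤ st.p r ∧ pbar d ≤ st.p d
  · rw [max_eq_left (sub_nonneg.2 hc.2), ← val_follow st _ _ (sub_pos.2 hlt)]
    obtain ⟨rfl, rfl⟩ | ⟨rfl, rfl⟩ := hij
    · simp [traceStep, h1, hc, hp, hlt]
    · simp [traceStep, h1, hc, hp, not_lt.2 hlt.le]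
  · have h0 : st.p d ≤ pbar d := by
      by_contra hgt
      exact hc ⟨h.resolve_right hgt, (not_le.1 hgt).le⟩
    rw [max_eq_right (sub_nonpos.2 h0), moved_zero]
    obtain ⟨rfl, rfl⟩ | ⟨rfl, rfl⟩ := hij
    · simp only [not_and, not_le] at hc
      by_cases h2 : pbar b.i ≤ st.p b.i
      · simp [traceStep, h1, hp, h2, not_le.2 (hc h2)]
      · simp [traceStep, h1, hp, h2]
    · simp only [not_and, not_le] at hc
      by_cases h2 : pbar b.j ≤ st.p b.j
      · simp [traceStep, h1, hp, h2, not_le.2 (hc h2)]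
      · simp [traceStep, h1, hp, h2]

theorem weightedL1_transfer (w pbar p : Fin S → ℝ) {r d : Fin S} (h : r ≠ d) (δ : ℝ) :
    weightedL1 w (transfer p r d δ - pbar) = weightedL1 w (p - pbar) +
      (w r * |p r + δ - pbar r| - w r * |p r - pbar r|) +
      (w d * |p d - δ - pbar d| - w d * |p d - pbar d|) := by
  simp only [weightedL1, Pi.sub_apply]
  exact sum_transfer p h δ (fun i x => w i * |x - pbar i|)

theorem sum_mul_transfer (z p : Fin S → ℝ) {r d : Fin S} (h : r ≠ d) (δ : ℝ) :
    ∑ i, transfer p r d δ i * z i = ∑ i, p i * z i + δ * (z r - z d) := by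
  rw [sum_transfer p h δ (fun i x => x * z i)]
  ring

theorem le_one_of_mem_stdSimplex {p : Fin S → ℝ} (hp : p ∈ stdSimplex ℝ (Fin S)) (i : Fin S) :
    p i ≤ 1 :=
  hp.2 ▸ Finset.single_le_sum (fun j _ => hp.1 j) (Finset.mem_univ i)

/-- One iteration of the tracing loop maintains the invariant, and its outcome lies on the same
level of the Lagrangian. -/
theorem traceStep_spec {z w pbar : Fin S → ℝ} {pre suf : List (Basis S)} {b : Basis S}
    {st : State S} (hw : ∀ i, 0 < w i) (hD : IsBasisList z w (pre ++ b :: suf))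
    (h : TraceInv z w pbar pre (b :: suf) st.p) (hξ : st.ξ = weightedL1 w (st.p - pbar))
    (hq : st.q = ∑ i, st.p i * z i) (hpbar : ∀ i, 0 ≤ pbar i) :
    ∃ st', (traceStep w pbar st b).val = st' ∧ TraceInv z w pbar (pre ++ [b]) suf st'.p ∧
      st'.ξ = weightedL1 w (st'.p - pbar) ∧ st'.q = ∑ i, st'.p i * z i ∧
      st'.points = (st'.ξ, st'.q) :: st.points ∧ st.ξ ≤ st'.ξ ∧
      st'.q - b.slope * st'.ξ = st.q - b.slope * st.ξ := by
  have hneg := hD.slope_neg_head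
  have key : ∃ r d δ W, r ≠ d ∧ 0 < W ∧ 0 ≤ δ ∧
      (traceStep w pbar st b).val = st.moved b.slope W r d δ ∧
      TraceInv z w pbar (pre ++ [b]) suf (transfer st.p r d δ) ∧
      weightedL1 w (transfer st.p r d δ - pbar) = weightedL1 w (st.p - pbar) + δ * W ∧
      z r - z d = b.slope * W := by
    obtain ⟨r, d, hb | hb⟩ := hD.cases b (by simp)
    · have hrd := hb.ne hw hneg
      have h0 := h.mem.1 d
      -- Along a C1 basis `z r + l w r = z d - l w d`. A cheaper receiver `k` would thus have
      -- drained `d` at an earlier slope.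
      have hr : 0 < st.p d → ∀ k, z r - z k ≤ b.slope * (w r - w k) := by
        intro hpd k
        by_contra hlt
        refine hpd.ne' (h.eq_zero hD hw (i := k) ?_)
        linarith [hb.slope]
      -- An excess at `d` would require `z d + l w d ≤ z r + l w r = z d - l w d`, impossible since
      -- `l` and `w d` are positive.
      have hd : st.p d ≤ pbar d := by
        by_contra hgt
        have := h.surplus_le hD (not_le.1 hgt) r
        nlinarith [hb.slope, hw d]
      refine ⟨r, d, st.p d, w r + w d, hrd, add_pos (hw r) (hw d), h0, ?_, ?_, ?_, hb.slope⟩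
      · refine val_traceStep_drain hw hb ?_
        rcases h0.eq_or_lt with h1 | h1
        · exact Or.inr h1.symm
        · exact Or.inl ⟨h.nominal_le hD hw (hr h1), le_one_of_mem_stdSimplex h.mem r, h0, hd⟩
      · refine h.step hD hw hrd h0 le_rfl (by rw [hb.tie]; exact hw r) hr ?_ ?_ ?_
        · intro r' d' hb'
          exact ⟨hb'.hj.symm.trans hb.hj, rfl⟩
        · intro r' d' hb'
          exact absurd (hb.isC2.symm.trans hb'.isC2) (by simp)
        · exact fun _ => Or.inr hb
      · rcases h0.eq_or_lt with h1 | h1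
        · rw [← h1, transfer_zero]; ring
        · have h2 := h.nominal_le hD hw (hr h1)
          rw [weightedL1_transfer w pbar st.p hrd, abs_of_nonneg (by linarith),
            abs_of_nonneg (by linarith), abs_of_nonpos (by linarith),
            abs_of_nonpos (by linarith)]
          ring
    · have hrd := hb.ne
      have hs := sub_pos.2 hb.lt
      have h0 := h.mem.1 d
      -- Along a C2 basis `z r + l w r = z d + l w d`, so `r` inherits optimality from a donor with
      -- excess.
      have hr : pbar d < st.p d → ∀ k, z r - z k ≤ b.slope * (w r - w k) := by
        intro hpd k
        linarith [h.surplus_le hD hpd k, hb.slope]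
      have hδ : 0 < max (st.p d - pbar d) 0 → pbar d < st.p d := by
        intro h1
        by_contra h2
        rw [max_eq_right (by linarith)] at h1
        exact lt_irrefl _ h1
      refine ⟨r, d, max (st.p d - pbar d) 0, w r - w d, hrd, hs, le_max_right _ _,
        val_traceStep_shift hb (le_one_of_mem_stdSimplex h.mem) ?_, ?_, ?_, hb.slope⟩
      · rcases le_or_gt (st.p d) (pbar d) with h1 | h1
        · exact Or.inr h1
        · exact Or.inl (h.nominal_le hD hw (hr h1))
      · refine h.step hD hw hrd (le_max_right _ _) (max_le (by linarith [hpbar d]) h0)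
          (by rw [hb.tie]; exact hb.lt) (fun h1 => hr (hδ h1)) ?_ ?_ ?_
        · intro r' d' hb'
          exact absurd (hb'.isC2.symm.trans hb.isC2) (by simp)
        · intro r' d' hb'
          refine ⟨?_, by linarith [le_max_left (st.p d - pbar d) 0]⟩
          -- The tie value is the donor's weight and the donor is strictly lighter, so two readings
          -- of the same basis cannot exchange the roles of its states.
          have h1 := hb'.tie.symm.trans hb.tie
          have h2 := hb.lt
          have h3 := hb'.lt
          obtain ⟨h4, h5⟩ | ⟨h4, h5⟩ := hb.hij <;> obtain ⟨h6, h7⟩ | ⟨h6, h7⟩ := hb'.hij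
          · exact h7.symm.trans h5
          · rw [← h6, h4] at h1; linarith
          · rw [← h7, h5] at h1; linarith
          · exact h6.symm.trans h4
        · intro h1
          left
          by_contra h2
          rw [max_eq_left (by linarith)] at h1
          linarith
      · rcases le_or_gt (st.p d) (pbar d) with h1 | h1
        · rw [max_eq_right (by linarith), transfer_zero]; ring
        · have h2 := h.nominal_le hD hw (hr h1)
          rw [max_eq_left (by linarith), weightedL1_transfer w pbar st.p hrd,
            abs_of_nonneg (by linarith), abs_of_nonneg (by linarith), sub_sub_cancel,
            sub_self, abs_zero, abs_of_nonneg (by linarith)]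
          ring
  obtain ⟨r, d, δ, W, hrd, hW, hδ, e, hinv, hnorm, hslope⟩ := key
  refine ⟨_, e, hinv, ?_, ?_, rfl, ?_, ?_⟩
  · simp only [State.moved]; rw [hnorm, hξ]
  · simp only [State.moved]; rw [sum_mul_transfer z st.p hrd, hq, hslope]; ring
  · simp only [State.moved]; nlinarith
  · simp only [State.moved]; ring

/-! ### The points recorded by the homotopy method -/

/-- The point `(ξ, q)` is attained by a distribution `p` at distance `ξ` of `pbar`. -/
def Attained (z w pbar : Fin S → ℝ) (x : ℝ × ℝ) : Prop :=
  ∃ p ∈ stdSimplex ℝ (Fin S), weightedL1 w (p - pbar) = x.1 ∧ ∑ i, p i * z i = x.2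

/-- The line of slope `-l` through the point `x` lies below all attained points. -/
def Supports (z w pbar : Fin S → ℝ) (l : ℝ) (x : ℝ × ℝ) : Prop :=
  ∀ p ∈ stdSimplex ℝ (Fin S), x.2 + l * x.1 ≤ ∑ i, p i * z i + l * weightedL1 w (p - pbar)

/-- The points `x` and `y` lie on a common supporting line, `x` to the right of `y`. -/
def Segment (z w pbar : Fin S → ℝ) (x y : ℝ × ℝ) : Prop :=
  y.1 ≤ x.1 ∧ ∃ l, 0 < l ∧ Supports z w pbar l y ∧ x.2 + l * x.1 = y.2 + l * y.1

/-- The points `(ξ_t, q_t)`, `t = T, …, 0`, describe the lower envelope of the attained points. -/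
structure IsTrace (z w pbar : Fin S → ℝ) (pts : List (ℝ × ℝ)) : Prop where
  attained : ∀ x ∈ pts, Attained z w pbar x
  chain : pts.IsChain (Segment z w pbar)
  head : ∃ x ∈ pts.head?, ∀ p ∈ stdSimplex ℝ (Fin S), x.2 ≤ ∑ i, p i * z i
  last : ∃ x ∈ pts.getLast?, x.1 = 0

/-- The supporting line of each segment is the Lagrangian bound at its older endpoint, with the
slope of the basis followed; the newer endpoint lies on the same line. After the last basis, all
mass sits on minimizers of `z`. -/
theorem trace_spec {z w pbar : Fin S → ℝ} (hw : ∀ i, 0 < w i) (hpbar : ∀ i, 0 ≤ pbar i)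
    (pre suf : List (Basis S)) (st : State S) (hD : IsBasisList z w (pre ++ suf))
    (h : TraceInv z w pbar pre suf st.p) (hξ : st.ξ = weightedL1 w (st.p - pbar))
    (hq : st.q = ∑ i, st.p i * z i) (hhead : ∃ l, st.points = (st.ξ, st.q) :: l)
    (hatt : ∀ x ∈ st.points, Attained z w pbar x)
    (hchain : st.points.IsChain (Segment z w pbar))
    (hlast : ∃ x ∈ st.points.getLast?, x.1 = 0) :
    IsTrace z w pbar (forEach (traceStep w pbar) suf st).val.points := by
  induction suf generalizing pre st with
  | nil =>
    rw [List.append_nil] at hD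
    obtain ⟨l, hl⟩ := hhead
    refine ⟨hatt, hchain, ⟨(st.ξ, st.q), ?_, fun p hp => ?_⟩, hlast⟩
    · rw [val_forEach_nil, hl]; simp
    · dsimp only
      rw [hq]
      exact h.sum_mul_le hD hp
  | cons b suf ih =>
    obtain ⟨st', e, hinv, hξ', hq', hpts, hle, hline⟩ := traceStep_spec hw hD h hξ hq hpbar
    rw [val_forEach_cons, e]
    obtain ⟨l, hl⟩ := hhead
    refine ih (pre ++ [b]) st' (by simpa using hD) hinv hξ' hq' ⟨_, hpts⟩ ?_ ?_ ?_
    · intro x hx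
      rw [hpts, List.mem_cons] at hx
      rcases hx with rfl | hx
      · exact ⟨st'.p, hinv.mem, hξ'.symm, hq'.symm⟩
      · exact hatt x hx
    · rw [hpts, hl, List.isChain_cons_cons, ← hl]
      refine ⟨⟨hle, -b.slope, neg_pos.2 hD.slope_neg_head, fun p hp => ?_, ?_⟩, hchain⟩
      · have := h.lagrangian_le hD hw hp
        rw [← hξ, ← hq] at this
        exact this
      · dsimp only
        linarith
    · rw [hpts, hl, List.getLast?_cons_cons, ← hl]
      exact hlast

theorem isTrace_homotopy {z w pbar : Fin S → ℝ} (hw : ∀ i, 0 < w i)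
    (hpbar : pbar ∈ stdSimplex ℝ (Fin S)) :
    IsTrace z w pbar (homotopy z w pbar).val.toList := by
  have hq : (forFin S (fun q i => do
      let pi ← readCell pbar i
      let zi ← readCell z i
      let x ← mul pi zi
      add q x) 0).val = ∑ i, pbar i * z i := by
    rw [val_forFin_add _ (fun i => pbar i * z i) (fun _ _ => rfl), zero_add]
  have h0 : weightedL1 w (pbar - pbar) = 0 := by simp [weightedL1]
  simp only [homotopy, val_bind, val_copy, val_store, val_cons]
  refine trace_spec hw hpbar.1 [] _ _ (isBasisList_sortedBases z w hw) ?_ h0.symm hq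
    ⟨_, rfl⟩ ?_ (by simp) (by simp)
  · exact ⟨hpbar, by simp, by simp, fun d hd => absurd hd (lt_irrefl _),
      fun j hj => absurd hj (lt_irrefl _)⟩
  · intro x hx
    rw [List.mem_singleton] at hx
    subst hx
    exact ⟨pbar, hpbar, h0, hq.symm⟩

end HomotopyMethod

/-! ### Inverting the piecewise affine functions and summing the inverses. -/

namespace BisectionMethod

open Timed HomotopyMethod

variable {S A : ℕ}

theorem weightedL1_nonneg {w : Fin S → ℝ} (hw : ∀ i, 0 < w i) (x : Fin S → ℝ) :
    0 ≤ weightedL1 w x :=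
  Finset.sum_nonneg fun i _ => mul_nonneg (hw i).le (abs_nonneg _)

theorem weightedL1_combo_le {w : Fin S → ℝ} (hw : ∀ i, 0 < w i) (p p' pbar : Fin S → ℝ) {s t : ℝ}
    (hs : 0 ≤ s) (ht : 0 ≤ t) (hst : s + t = 1) :
    weightedL1 w (s • p + t • p' - pbar) ≤
      s * weightedL1 w (p - pbar) + t * weightedL1 w (p' - pbar) := by
  simp only [weightedL1, Finset.mul_sum]
  rw [← Finset.sum_add_distrib]
  refine Finset.sum_le_sum fun i _ => ?_
  have e : (s • p + t • p' - pbar) i = s * (p i - pbar i) + t * (p' i - pbar i) := by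
    simp only [Pi.sub_apply, Pi.add_apply, Pi.smul_apply, smul_eq_mul]
    linear_combination (pbar i) * hst
  rw [e]
  have h := abs_add_le (s * (p i - pbar i)) (t * (p' i - pbar i))
  rw [abs_mul, abs_mul, abs_of_nonneg hs, abs_of_nonneg ht] at h
  have := mul_le_mul_of_nonneg_left h (hw i).le
  simp only [Pi.sub_apply]
  linarith

theorem sum_combo_mul (p p' z : Fin S → ℝ) (s t : ℝ) :
    ∑ i, (s • p + t • p') i * z i = s * ∑ i, p i * z i + t * ∑ i, p' i * z i := by
  rw [Finset.mul_sum, Finset.mul_sum, ← Finset.sum_add_distrib]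
  refine Finset.sum_congr rfl fun i _ => ?_
  simp only [Pi.add_apply, Pi.smul_apply, smul_eq_mul]
  ring

/-- `ξ` is the least distance of `pbar` at which the objective value `u` can be reached, the line of
slope `-m` through `(u, ξ)` is a lower bound for the distances at other values, and it is attained
up to the next breakpoint. -/
structure IsInverse (z w pbar : Fin S → ℝ) (pts : List (ℝ × ℝ)) (u ξ m : ℝ) : Prop where
  nonneg : 0 ≤ m
  le : ∀ p ∈ stdSimplex ℝ (Fin S), ξ ≤ weightedL1 w (p - pbar) + m * (∑ i, p i * z i - u)
  exists_le : ∀ u', u ≤ u' → (∀ x ∈ pts, u < x.2 → u' ≤ x.2) →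
    ∃ p ∈ stdSimplex ℝ (Fin S), ∑ i, p i * z i ≤ u' ∧ weightedL1 w (p - pbar) ≤ ξ - m * (u' - u)

/-- On a segment of slope `-l` the inverse has slope `-1 / l`, so `m = 1 / l`. The lower bound is
the supporting line divided by `l`. For attainment, the two endpoint distributions are mixed: the
objective interpolates exactly, and the distance is at most the interpolated one by convexity. -/
theorem Segment.isInverse {z w pbar : Fin S → ℝ} (hw : ∀ i, 0 < w i) {pts : List (ℝ × ℝ)}
    {x y : ℝ × ℝ} (hy : y ∈ pts) (hxa : Attained z w pbar x) (hya : Attained z w pbar y)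
    (h : Segment z w pbar x y) {u : ℝ} (hxu : x.2 ≤ u) (huy : u < y.2) :
    ∃ m, IsInverse z w pbar pts u (y.1 + (y.2 - u) / (y.2 - x.2) * (x.1 - y.1)) m := by
  obtain ⟨-, l, hl, hsup, hline⟩ := h
  have hxy : 0 < y.2 - x.2 := by linarith
  have e : ∀ v, (y.2 - v) / (y.2 - x.2) * (x.1 - y.1) = (y.2 - v) / l := by
    intro v
    have : x.1 - y.1 = (y.2 - x.2) / l := by field_simp; linarith
    rw [this]
    field_simp
  rw [e]
  refine ⟨1 / l, by positivity, fun p hp => ?_, fun u' hu hu' => ?_⟩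
  · have := hsup p hp
    have h2 : l * (weightedL1 w (p - pbar) + 1 / l * (∑ i, p i * z i - u) -
      (y.1 + (y.2 - u) / l)) = l * weightedL1 w (p - pbar) + ∑ i, p i * z i - y.2 - l * y.1 := by
      field_simp; ring
    have h3 : 0 ≤ l * (weightedL1 w (p - pbar) + 1 / l * (∑ i, p i * z i - u) -
      (y.1 + (y.2 - u) / l)) := by rw [h2]; linarith
    linarith [nonneg_of_mul_nonneg_right h3 hl]
  · have hu'y := hu' y hy huy
    obtain ⟨p, hp, hp1, hp2⟩ := hxa
    obtain ⟨p', hp', hp1', hp2'⟩ := hya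
    set t := (y.2 - u') / (y.2 - x.2) with ht
    have ht0 : 0 ≤ t := div_nonneg (by linarith) hxy.le
    have ht1 : t ≤ 1 := (div_le_one hxy).2 (by linarith)
    have htm : t * (y.2 - x.2) = y.2 - u' := div_mul_cancel₀ _ hxy.ne'
    refine ⟨t • p + (1 - t) • p', convex_stdSimplex ℝ (Fin S) hp hp' ht0 (by linarith) (by ring),
      ?_, ?_⟩
    · rw [sum_combo_mul, hp2, hp2']
      linarith
    · refine (weightedL1_combo_le hw p p' pbar ht0 (sub_nonneg.2 ht1) (by ring)).trans ?_
      rw [hp1, hp1']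
      have e2 := e u'
      rw [← ht] at e2
      have e3 : (y.2 - u) / l - 1 / l * (u' - u) = (y.2 - u') / l := by field_simp; ring
      linarith

theorem val_inverse (pts : Array (ℝ × ℝ)) (u : ℝ) :
    (inverse pts u).val = if u < (pts.getD 0 (0, 0)).2 then none
      else if (pts.getD (pts.size - 1) (0, 0)).2 ≤ u then some 0
      else
        let k := (bisect (fun k => readAt pts k (0, 0) >>= fun x => lt u x.2) 0 (pts.size - 1)).val
        let x := pts.getD k.1 (0, 0)
        let y := pts.getD k.2 (0, 0)
        some (y.1 + (y.2 - u) / (y.2 - x.2) * (x.1 - y.1)) := by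
  rw [inverse]
  by_cases h1 : u < (pts.getD 0 (0, 0)).2
  · simp [h1, -Array.getD_eq_getD_getElem?]
  · by_cases h2 : (pts.getD (pts.size - 1) (0, 0)).2 ≤ u
    · simp [h1, h2, -Array.getD_eq_getD_getElem?]
    · simp [h1, h2, -Array.getD_eq_getD_getElem?]

theorem getD_eq_getElem {α : Type} (l : Array α) {k : ℕ} (h : k < l.size) (x : α) :
    l.getD k x = l[k] := by
  simp [Array.getD, h]

theorem inverse_spec {z w pbar : Fin S → ℝ} (hw : ∀ i, 0 < w i) {pts : Array (ℝ × ℝ)}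
    (h : IsTrace z w pbar pts.toList) (u : ℝ) :
    ((inverse pts u).val = none ∧ ∃ x ∈ pts.toList, u < x.2 ∧
      ∀ p ∈ stdSimplex ℝ (Fin S), x.2 ≤ ∑ i, p i * z i) ∨
    ∃ ξ m, (inverse pts u).val = some ξ ∧ IsInverse z w pbar pts.toList u ξ m := by
  obtain ⟨x, hx, hmin⟩ := h.head
  obtain ⟨y, hy, hy0⟩ := h.last
  have hsize : 0 < pts.size := by
    rcases Nat.eq_zero_or_pos pts.size with h0 | h0
    · rw [Array.size_eq_zero_iff] at h0; subst h0; simp at hx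
    · exact h0
  have ex : pts.getD 0 (0, 0) = x := by
    rw [getD_eq_getElem _ hsize]
    simpa [List.head?_eq_getElem?, hsize] using hx
  have ey : pts.getD (pts.size - 1) (0, 0) = y := by
    rw [getD_eq_getElem _ (by omega)]
    simpa [List.getLast?_eq_getElem?, hsize] using hy
  have hmem : ∀ k < pts.size, pts.getD k (0, 0) ∈ pts.toList := by
    intro k hk
    rw [getD_eq_getElem _ hk]
    simp
  rw [val_inverse, ex, ey]
  split_ifs with h1 h2
  · exact Or.inl ⟨rfl, x, ex ▸ hmem 0 hsize, h1, hmin⟩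
  · right
    obtain ⟨p, hp, hp1, hp2⟩ := h.attained y (ey ▸ hmem _ (by omega))
    refine ⟨0, 0, rfl, le_rfl, fun p' _ => ?_, fun u' hu' _ => ⟨p, hp, by linarith, by linarith⟩⟩
    linarith [weightedL1_nonneg hw (p' - pbar)]
  · right
    obtain ⟨-, -, b3, b4, b5, b6, b7⟩ :=
      bisect_spec (fun k => readAt pts k (0, 0) >>= fun x => lt u x.2) 0 (pts.size - 1)
        (by omega)
    -- A single point would have `q_T = q_0`, and one of the first two cases would apply.
    have hpos : 0 < pts.size - 1 := by
      by_contra h0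
      have h3 : pts.size - 1 = 0 := by omega
      rw [h3, ex] at ey
      rw [ey] at h1
      exact h2 (not_lt.1 h1)
    generalize (bisect (fun k => readAt pts k (0, 0) >>= fun x => lt u x.2) 0 (pts.size - 1)).val = k at *
    obtain ⟨lo, hi⟩ := k
    dsimp only at b3 b4 b5 b6 b7 ⊢
    have b5 := b5 hpos
    -- The points are stored from the last to the first. The bracket `q_lo ≤ u < q_hi` excludes
    -- repeated points, so the division in the interpolation is legitimate.
    obtain rfl : hi = lo + 1 := by omega
    have hlo : (pts.getD lo (0, 0)).2 ≤ u := by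
      rcases b6 with rfl | b6
      · rw [ex]; exact not_lt.1 h1
      · simpa using b6
    have hhi : u < (pts.getD (lo + 1) (0, 0)).2 := by
      rcases b7 with b7 | b7
      · rw [b7, ey]; exact not_le.1 h2
      · simpa using b7
    have hseg : Segment z w pbar (pts.getD lo (0, 0)) (pts.getD (lo + 1) (0, 0)) := by
      have := List.isChain_iff_getElem.1 h.chain lo (by simp; omega)
      rw [getD_eq_getElem _ (by omega), getD_eq_getElem _ (by omega)]
      simpa using this
    have m₁ := hmem lo (by omega)
    have m₂ := hmem (lo + 1) (by omega)
    obtain ⟨m, hm⟩ := Segment.isInverse hw m₂ (h.attained _ m₁) (h.attained _ m₂) hseg hlo hhi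
    exact ⟨_, m, rfl, hm⟩

theorem val_budget (pts : Fin A → Array (ℝ × ℝ)) (u : ℝ) :
    ((budget pts u).val = none ∧ ∃ a, (inverse (pts a) u).val = none) ∨
    ∃ ξ : Fin A → ℝ, (∀ a, (inverse (pts a) u).val = some (ξ a)) ∧
      (budget pts u).val = some (∑ a, ξ a) := by
  set body : Option ℝ → Fin A → Timed (Option ℝ) := fun s a => do
    let l ← readCell pts a
    let x ← inverse l u
    tick 1
    match s, x with
    | some s, some x => do
      let y ← Timed.add s x
      return some y
    | _, _ => return none with hbody
  have hnone : ∀ l : List (Fin A), (forEach body l none).val = none := by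
    intro l
    induction l with
    | nil => rfl
    | cons a l ih =>
      rw [val_forEach_cons]
      have : (body none a).val = none := rfl
      rw [this, ih]
  by_cases hall : ∀ a, ∃ ξ, (inverse (pts a) u).val = some ξ
  · right
    choose ξ hξ using hall
    refine ⟨ξ, hξ, ?_⟩
    have key : ∀ (l : List (Fin A)) (s : ℝ),
        (forEach body l (some s)).val = some (s + (l.map ξ).sum) := by
      intro l
      induction l with
      | nil => simp
      | cons a l ih =>
        intro s
        have : (body (some s) a).val = some (s + ξ a) := by
          simp [hbody, hξ]
        rw [val_forEach_cons, this, ih]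
        simp [add_assoc]
    show (forEach body (List.finRange A) (some 0)).val = _
    rw [key, ← List.ofFn_eq_map, List.sum_ofFn, zero_add]
  · left
    push Not at hall
    obtain ⟨a, ha⟩ := hall
    have ha : (inverse (pts a) u).val = none := Option.eq_none_iff_forall_ne_some.2 ha
    refine ⟨?_, a, ha⟩
    have key : ∀ (l : List (Fin A)) (s : Option ℝ), a ∈ l → (forEach body l s).val = none := by
      intro l
      induction l with
      | nil => simp
      | cons c l ih =>
        intro s hl
        rw [val_forEach_cons]
        rcases List.mem_cons.1 hl with rfl | hl
        · have : (body s a).val = none := by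
            cases s <;> simp [hbody, ha]
          rw [this, hnone]
        · exact ih _ hl
    exact key _ _ (List.mem_finRange a)

theorem combine_spec (pts : Fin A → Array (ℝ × ℝ)) :
    (combine pts).val.toList.Pairwise (· < ·) ∧
    ∀ u, u ∈ (combine pts).val.toList ↔ ∃ a, ∃ x ∈ (pts a).toList, x.2 = u := by
  have hs := fun l : List ℝ => pairwise_mergeSort Timed.le (· ≤ ·) (fun x y z h h' => h.trans h')
    (fun x y h => by simpa using h) (fun x y h => (not_le.1 (by simpa using h)).le) l
  simp only [combine, val_bind, val_store]
  refine ⟨pairwise_dropDuplicates _ (hs _), fun u => ?_⟩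
  rw [mem_dropDuplicates _ (hs _), (perm_mergeSort _ _).mem_iff,
    mem_forFin_iff _ (fun a u => ∃ k : Fin (pts a).size, u = ((pts a).getD k (0, 0)).2)]
  · simp only [List.not_mem_nil, false_or]
    refine exists_congr fun a => ⟨?_, ?_⟩
    · rintro ⟨k, rfl⟩
      refine ⟨_, ?_, rfl⟩
      rw [getD_eq_getElem _ k.2]
      simp
    · rintro ⟨x, hx, rfl⟩
      obtain ⟨k, hk, rfl⟩ := List.getElem_of_mem hx
      refine ⟨⟨k, by simpa using hk⟩, ?_⟩
      rw [getD_eq_getElem _ (by simpa using hk)]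
      simp
  · intro K a u
    simp only [val_bind, val_readCell]
    rw [mem_forFin_iff _ (fun k u => u = ((pts a).getD k (0, 0)).2)]
    intro K k u
    simp [or_comm]

end BisectionMethod

/-! ### Optimality of the value returned by the bisection. -/

namespace BisectionMethod

open Timed HomotopyMethod

variable {S A : ℕ}

/-- The objective value `u` can be reached for all actions within the budget `κ`. -/
def Feasible (z w pbar : Fin A → Fin S → ℝ) (κ u : ℝ) : Prop :=
  ∃ p : Fin A → Fin S → ℝ, (∀ a, p a ∈ stdSimplex ℝ (Fin S)) ∧
    ∑ a, weightedL1 (w a) (p a - pbar a) ≤ κ ∧ ∀ a, ∑ i, p a i * z a i ≤ u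

section

variable {z w pbar : Fin A → Fin S → ℝ} {pts : Fin A → Array (ℝ × ℝ)} {κ u : ℝ}

theorem budget_spec (hw : ∀ a i, 0 < w a i)
    (h : ∀ a, IsTrace (z a) (w a) (pbar a) (pts a).toList) (u : ℝ) :
    ((budget pts u).val = none ∧ ∃ a, ∃ x ∈ (pts a).toList, u < x.2 ∧
      ∀ p ∈ stdSimplex ℝ (Fin S), x.2 ≤ ∑ i, p i * z a i) ∨
    ∃ ξ m : Fin A → ℝ, (budget pts u).val = some (∑ a, ξ a) ∧
      ∀ a, IsInverse (z a) (w a) (pbar a) (pts a).toList u (ξ a) (m a) := by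
  rcases val_budget pts u with ⟨hb, a, ha⟩ | ⟨ξ, hξ, hb⟩
  · left
    rcases inverse_spec (hw a) (h a) u with ⟨-, hx⟩ | ⟨ξ, m, hξ, -⟩
    · exact ⟨hb, a, hx⟩
    · rw [ha] at hξ; cases hξ
  · right
    have : ∀ a, ∃ m, IsInverse (z a) (w a) (pbar a) (pts a).toList u (ξ a) m := by
      intro a
      rcases inverse_spec (hw a) (h a) u with ⟨hn, -⟩ | ⟨ξ', m, hξ', hm⟩
      · rw [hξ] at hn; cases hn
      · rw [hξ] at hξ'; cases hξ'
        exact ⟨m, hm⟩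
    choose m hm using this
    exact ⟨ξ, m, hb, hm⟩

/-- The subgradient inequalities of the actions, summed. They hold for `u'` on either side of `u`.
-/
theorem le_of_feasible {ξ m : Fin A → ℝ}
    (h : ∀ a, IsInverse (z a) (w a) (pbar a) (pts a).toList u (ξ a) (m a)) {u' : ℝ}
    (hf : Feasible z w pbar κ u') : ∑ a, ξ a ≤ κ + (∑ a, m a) * (u' - u) := by
  obtain ⟨p, hp, hκ, hu⟩ := hf
  have : ∑ a, ξ a ≤ ∑ a, (weightedL1 (w a) (p a - pbar a) + m a * (u' - u)) := by
    refine Finset.sum_le_sum fun a _ => ((h a).le (p a) (hp a)).trans ?_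
    have := mul_le_mul_of_nonneg_left (sub_le_sub_right (hu a) u) (h a).nonneg
    linarith
  rw [Finset.sum_add_distrib, ← Finset.sum_mul] at this
  linarith

theorem feasible_of_le {ξ m : Fin A → ℝ}
    (h : ∀ a, IsInverse (z a) (w a) (pbar a) (pts a).toList u (ξ a) (m a)) {u' : ℝ}
    (hu : u ≤ u') (hbreak : ∀ a, ∀ x ∈ (pts a).toList, u < x.2 → u' ≤ x.2)
    (hκ : ∑ a, ξ a - (∑ a, m a) * (u' - u) ≤ κ) : Feasible z w pbar κ u' := by
  choose p hp hpu hpξ using fun a => (h a).exists_le u' hu (hbreak a)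
  refine ⟨p, hp, (Finset.sum_le_sum fun a _ => hpξ a).trans ?_, hpu⟩
  rwa [Finset.sum_sub_distrib, ← Finset.sum_mul]

theorem val_isFeasible (s : Option ℝ) (κ : ℝ) :
    (isFeasible s κ).val = true ↔ ∃ x, s = some x ∧ x ≤ κ := by
  cases s <;> simp [isFeasible]

theorem isFeasible_budget_iff (hw : ∀ a i, 0 < w a i)
    (h : ∀ a, IsTrace (z a) (w a) (pbar a) (pts a).toList) (κ u : ℝ) :
    (∃ x, (budget pts u).val = some x ∧ x ≤ κ) ↔ Feasible z w pbar κ u := by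
  rcases budget_spec hw h u with ⟨hb, a, x, -, hux, hx⟩ | ⟨ξ, m, hb, hm⟩
  · rw [hb]
    simp only [reduceCtorEq, false_and, exists_false, false_iff]
    rintro ⟨p, hp, -, hpu⟩
    linarith [hx (p a) (hp a), hpu a]
  · rw [hb]
    constructor
    · rintro ⟨x, hx, hxκ⟩
      cases hx
      exact feasible_of_le hm le_rfl (fun a x _ hx => hx.le) (by simpa using hxκ)
    · intro hf
      exact ⟨_, rfl, by simpa using le_of_feasible hm hf⟩

/-- No breakpoint lies strictly between the two values left, so feasibility of `u'` in that interval
is the affine condition `∑ ξ - M (u' - umin) ≤ κ` with `M = ∑ m`. If the left end is out of reach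
for some action, that action's minimum is at least `umax`; otherwise the affine equation is solved.
-/
theorem isLeast_bisection (hA : 0 < A) (hw : ∀ a i, 0 < w a i)
    (h : ∀ a, IsTrace (z a) (w a) (pbar a) (pts a).toList) (hκ : 0 ≤ κ) :
    IsLeast {u | Feasible z w pbar κ u} (bisection κ pts).val := by
  obtain ⟨hsort, hmem⟩ := combine_spec pts
  set K := (combine pts).val with hK
  have hlast : ∀ a, ∃ p ∈ stdSimplex ℝ (Fin S), weightedL1 (w a) (p - pbar a) = 0 ∧
      ∑ i, p i * z a i ∈ K.toList := by
    intro a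
    obtain ⟨y, hy, hy0⟩ := (h a).last
    have hy := List.mem_of_getLast? hy
    obtain ⟨p, hp, hp1, hp2⟩ := (h a).attained y hy
    exact ⟨p, hp, hp1.trans hy0, (hmem _).2 ⟨a, y, hy, hp2.symm⟩⟩
  have hsize : 0 < K.size := by
    obtain ⟨p, -, -, hp⟩ := hlast ⟨0, hA⟩
    simpa using List.length_pos_of_mem hp
  have hlt : ∀ i j, i < j → j < K.size → K.getD i 0 < K.getD j 0 := by
    intro i j hij hj
    rw [getD_eq_getElem _ (by omega), getD_eq_getElem _ hj]
    have h1 := List.pairwise_iff_getElem.1 hsort i j (by simp; omega) (by simpa) hij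
    rwa [Array.getElem_toList, Array.getElem_toList] at h1
  have hidx : ∀ u ∈ K.toList, ∃ k, k < K.size ∧ K.getD k 0 = u := by
    intro u hu
    obtain ⟨k, hk, rfl⟩ := List.getElem_of_mem hu
    exact ⟨k, by simpa using hk, by rw [getD_eq_getElem _ (by simpa using hk)]; simp⟩
  have hle : ∀ i j, i ≤ j → j < K.size → K.getD i 0 ≤ K.getD j 0 := by
    intro i j hij hj
    rcases hij.eq_or_lt with rfl | hij
    · rfl
    · exact (hlt i j hij hj).le
  obtain ⟨-, b2, b3, b4, -, b6, b7⟩ := bisect_spec (fun k => readAt K k 0 >>= fun u =>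
    budget pts u >>= fun s => isFeasible s κ) 0 (K.size - 1) (by omega)
  simp only [bisection, val_bind]
  rw [← hK]
  generalize (bisect (fun k => readAt K k 0 >>= fun u =>
    budget pts u >>= fun s => isFeasible s κ) 0 (K.size - 1)).val = k at *
  obtain ⟨lo, hi⟩ := k
  simp only [val_bind, val_readAt] at b2 b3 b4 b6 b7 ⊢
  set umin := K.getD lo 0 with humin
  set umax := K.getD hi 0 with humax
  -- If the right end never moved, it is the largest breakpoint, which dominates all nominal values;
  -- these cost nothing.
  have hmax : Feasible z w pbar κ umax := by
    rcases b7 with b7 | b7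
    · choose p hp hp0 hpK using hlast
      refine ⟨p, hp, by simpa [hp0] using hκ, fun a => ?_⟩
      obtain ⟨k, hk, e⟩ := hidx _ (hpK a)
      rw [← e, humax, b7]
      exact hle _ _ (by omega) (by omega)
    · rwa [val_isFeasible, isFeasible_budget_iff hw h] at b7
  -- A feasible left end never failed a test, so it is the smallest breakpoint, and no action can be
  -- pushed below its own minimum.
  have hmin : ∀ u, Feasible z w pbar κ u → Feasible z w pbar κ umin → umin ≤ u := by
    rintro u ⟨p, hp, -, hpu⟩ hf
    rcases b6 with b6 | b6
    · obtain ⟨x, hx, hxmin⟩ := (h ⟨0, hA⟩).head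
      obtain ⟨k, hk, e⟩ := hidx x.2 ((hmem _).2 ⟨_, x, List.mem_of_head? hx, rfl⟩)
      have h1 := hle 0 k (by omega) hk
      rw [humin, b6]
      linarith [hxmin _ (hp ⟨0, hA⟩), hpu ⟨0, hA⟩]
    · rw [← isFeasible_budget_iff hw h, ← val_isFeasible] at hf
      rw [hf] at b6
      cases b6
  have hbreak : ∀ a, ∀ x ∈ (pts a).toList, umin < x.2 → umax ≤ x.2 := by
    intro a x hx hlx
    obtain ⟨k, hk, e⟩ := hidx x.2 ((hmem _).2 ⟨a, x, hx, rfl⟩)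
    rw [← e] at hlx ⊢
    refine hle _ _ ?_ hk
    by_contra hlt
    exact absurd (hle k lo (by omega) (by omega)) (not_le.2 hlx)
  have hmm : umin ≤ umax := hle _ _ b2 (by omega)
  rcases budget_spec hw h umin with ⟨hb, a, x, hx, hux, hxmin⟩ | ⟨ξ, m, hb, hm⟩
  · rw [hb]
    refine ⟨hmax, ?_⟩
    rintro u ⟨p, hp, -, hpu⟩
    exact (hbreak a x hx hux).trans ((hxmin _ (hp a)).trans (hpu a))
  · rcases budget_spec hw h umax with ⟨hb', a, x, hx, hux, hxmin⟩ | ⟨ξ', m', hb', hm'⟩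
    · obtain ⟨x, hx, -⟩ := (isFeasible_budget_iff hw h κ umax).2 hmax
      rw [hb'] at hx
      cases hx
    · rw [hb, hb']
      by_cases hs : ∑ a, ξ a ≤ κ
      · have hf := (isFeasible_budget_iff hw h κ umin).1 ⟨_, hb, hs⟩
        simp only [val_bind, val_le, hs, decide_true, if_true, val_pure]
        exact ⟨hf, fun u hu => hmin u hu hf⟩
      · simp only [val_bind, val_le, hs, decide_false, Bool.false_eq_true, if_false, val_sub,
          val_div, val_mul, val_add]
        have hM : 0 ≤ ∑ a, m a := Finset.sum_nonneg fun a _ => (hm a).nonneg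
        -- The budget at `umax` lies on the line found at `umin`. Each inequality follows by
        -- converting one side into feasibility, with that side itself as the budget, and back.
        have e : ∑ a, ξ' a = ∑ a, ξ a - (∑ a, m a) * (umax - umin) := by
          refine le_antisymm ?_ ?_
          · have := le_of_feasible hm' (feasible_of_le hm hmm hbreak le_rfl)
            simpa using this
          · have := le_of_feasible hm
              (feasible_of_le (κ := ∑ a, ξ' a) hm' le_rfl (fun a x _ hx => hx.le) (by simp))
            linarith
        have hmax' := le_of_feasible hm hmax
        have hsκ := not_le.1 hs
        have hMd : 0 < (∑ a, m a) * (umax - umin) := by linarith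
        have hMpos : 0 < ∑ a, m a := lt_of_le_of_ne hM (by rintro h0; rw [← h0] at hMd; simp at hMd)
        -- The interpolated value is the root of the affine equation, in which `M` is nonzero
        -- because `umax` is feasible and `umin` is not.
        have ex : (1 - (κ - ∑ a, ξ a) / (∑ a, ξ' a - ∑ a, ξ a)) * umin +
            (κ - ∑ a, ξ a) / (∑ a, ξ' a - ∑ a, ξ a) * umax =
            umin + (∑ a, ξ a - κ) / (∑ a, m a) := by
          have hd : umax - umin ≠ 0 := by rintro h0; rw [h0] at hMd; simp at hMd
          rw [e]
          have : ∑ a, ξ a - (∑ a, m a) * (umax - umin) - ∑ a, ξ a =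
            -((∑ a, m a) * (umax - umin)) := by ring
          rw [this]
          field_simp
          ring
        rw [ex]
        have hdm : (∑ a, m a) * ((∑ a, ξ a - κ) / (∑ a, m a)) = ∑ a, ξ a - κ :=
          mul_div_cancel₀ _ hMpos.ne'
        refine ⟨feasible_of_le hm ?_ (fun a x hx hlx => ?_) ?_, fun u hu => ?_⟩
        · have : 0 ≤ (∑ a, ξ a - κ) / (∑ a, m a) := div_nonneg (by linarith) hM
          linarith
        · refine le_trans ?_ (hbreak a x hx hlx)
          have : (∑ a, ξ a - κ) / (∑ a, m a) ≤ umax - umin := by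
            rw [div_le_iff₀ hMpos]; linarith
          linarith
        · rw [add_sub_cancel_left, hdm]; linarith
        · have := le_of_feasible hm hu
          have : (∑ a, ξ a - κ) / (∑ a, m a) ≤ u - umin := by
            rw [div_le_iff₀ hMpos]; linarith
          linarith

end

end BisectionMethod

/-! ### Minimax duality and correctness of the combined algorithm. -/

namespace RMDP

open Timed HomotopyMethod BisectionMethod

variable {S A : ℕ}

/-- The minimax theorem for the randomized actions: some `d` guarantees the value `u`. -/
theorem exists_le_sum_mul {T : Set (Fin A → ℝ)} (hT : Convex ℝ T) (hne : T.Nonempty) {u : ℝ}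
    (h : ∀ x ∈ T, ∃ a, u ≤ x a) :
    ∃ d ∈ stdSimplex ℝ (Fin A), ∀ x ∈ T, u ≤ ∑ a, d a * x a := by
  have hs : {x : Fin A → ℝ | ∀ a, x a < u} = Set.univ.pi fun _ => Set.Iio u := by
    ext x; simp
  have hconv : Convex ℝ {x : Fin A → ℝ | ∀ a, x a < u} := by
    rw [hs]; exact convex_pi fun _ _ => convex_Iio u
  have hopen : IsOpen {x : Fin A → ℝ | ∀ a, x a < u} := by
    rw [hs]; exact isOpen_set_pi Set.finite_univ fun _ _ => isOpen_Iio
  obtain ⟨f, c, hf, hc⟩ := geometric_hahn_banach_open hconv hopen hT (by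
    rw [Set.disjoint_left]
    intro x hx hxT
    obtain ⟨a, ha⟩ := h x hxT
    exact absurd (hx a) (not_lt.2 ha))
  set e : Fin A → ℝ := fun a => f (Pi.single a 1) with he
  have hfe : ∀ x : Fin A → ℝ, f x = ∑ a, e a * x a := by
    intro x
    have := LinearMap.pi_apply_eq_sum_univ (f : (Fin A → ℝ) →ₗ[ℝ] ℝ) x
    simp only [ContinuousLinearMap.coe_coe, smul_eq_mul] at this
    rw [this]
    refine Finset.sum_congr rfl fun a _ => ?_
    rw [mul_comm, he]
    congr 2
    ext b
    simp [Pi.single_apply, eq_comm]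
  -- Constant vectors just below `u` lie in the open orthant; letting `ε` tend to `0` later bounds
  -- `u` times the total weight by `c`.
  have hconst : ∀ ε > 0, (∑ a, e a) * (u - ε) < c := by
    intro ε hε
    have := hf (fun _ => u - ε) (fun _ => by linarith)
    rwa [hfe, ← Finset.sum_mul] at this
  have hnonneg : ∀ a, 0 ≤ e a := by
    intro a
    by_contra hneg
    rw [not_le] at hneg
    have h1 := hconst 1 one_pos
    -- A negative coefficient would let the functional grow along `-Pi.single a 1` inside the
    -- orthant; at this `t` it reaches `c` exactly, against strict separation.
    set t := (c - (∑ a, e a) * (u - 1)) / (-e a) with ht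
    have htpos : 0 < t := div_pos (by linarith) (by linarith)
    have htm : t * (-e a) = c - (∑ a, e a) * (u - 1) := div_mul_cancel₀ _ (by linarith)
    have := hf ((fun _ => u - 1) - Pi.single a t) (fun b => by
      simp only [Pi.sub_apply]
      have : 0 ≤ (Pi.single a t : Fin A → ℝ) b := by
        by_cases hb : b = a
        · subst hb; simpa using htpos.le
        · simp [hb]
      linarith)
    rw [hfe] at this
    simp only [Pi.sub_apply, mul_sub, Finset.sum_sub_distrib, Pi.single_apply] at this
    simp at this
    rw [← Finset.sum_mul] at this
    linarith
  have hsum : 0 ≤ ∑ a, e a := Finset.sum_nonneg fun a _ => hnonneg a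
  have hpos : 0 < ∑ a, e a := by
    refine lt_of_le_of_ne hsum fun h0 => ?_
    obtain ⟨x, hx⟩ := hne
    have h1 := hc x hx
    have h2 := hconst 1 one_pos
    have h3 : ∀ a, e a = 0 := fun a =>
      (Finset.sum_eq_zero_iff_of_nonneg fun a _ => hnonneg a).1 h0.symm a (Finset.mem_univ a)
    rw [hfe] at h1
    simp [h3] at h1 h2
    linarith
  have hcu : (∑ a, e a) * u ≤ c := by
    refine le_of_forall_pos_le_add fun ε hε => ?_
    have := hconst (ε / ∑ a, e a) (div_pos hε hpos)
    rw [mul_sub, mul_div_cancel₀ _ hpos.ne'] at this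
    linarith
  refine ⟨fun a => e a / ∑ a, e a, ⟨fun a => div_nonneg (hnonneg a) hsum, ?_⟩, fun x hx => ?_⟩
  · rw [← Finset.sum_div, div_self hpos.ne']
  · have h1 := hc x hx
    rw [hfe] at h1
    have : ∑ a, e a / (∑ a, e a) * x a = (∑ a, e a * x a) / ∑ a, e a := by
      rw [Finset.sum_div]
      exact Finset.sum_congr rfl fun a _ => by ring
    rw [this, le_div_iff₀ hpos]
    linarith

theorem sum_mul_le_of_mem_stdSimplex {d x : Fin A → ℝ} (hd : d ∈ stdSimplex ℝ (Fin A)) {u : ℝ}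
    (h : ∀ a, x a ≤ u) : ∑ a, d a * x a ≤ u := by
  have := Finset.sum_le_sum fun a (_ : a ∈ Finset.univ) => mul_le_mul_of_nonneg_left (h a) (hd.1 a)
  rwa [← Finset.sum_mul, hd.2, one_mul] at this

theorem convex_ambiguitySet (M : RMDP S A) (s : Fin S) : Convex ℝ (M.ambiguitySet s) := by
  intro p hp p' hp' a b ha hb hab
  refine ⟨fun c => convex_stdSimplex ℝ (Fin S) (hp.1 c) (hp'.1 c) ha hb hab, ?_⟩
  calc ∑ c, weightedL1 (M.w s c) ((a • p + b • p') c - M.pbar s c)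
      ≤ ∑ c, (a * weightedL1 (M.w s c) (p c - M.pbar s c) +
          b * weightedL1 (M.w s c) (p' c - M.pbar s c)) :=
        Finset.sum_le_sum fun c _ =>
          weightedL1_combo_le (M.w_pos s c) (p c) (p' c) (M.pbar s c) ha hb hab
    _ ≤ a * M.κ s + b * M.κ s := by
        rw [Finset.sum_add_distrib, ← Finset.mul_sum, ← Finset.mul_sum]
        exact add_le_add (mul_le_mul_of_nonneg_left hp.2 ha) (mul_le_mul_of_nonneg_left hp'.2 hb)
    _ = M.κ s := by rw [← add_mul, hab, one_mul]

/-- The robust Bellman operator as the least value that the adversary can enforce for all actions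
within the budget. -/
theorem robustBellman_eq (M : RMDP S A) (v : Fin S → ℝ) (s : Fin S) {u : ℝ}
    (h : IsLeast {u | Feasible (fun a i => M.r s a i + M.γ * v i) (M.w s) (M.pbar s) (M.κ s) u} u) :
    M.robustBellman v s = u := by
  set z : Fin A → Fin S → ℝ := fun a i => M.r s a i + M.γ * v i with hz
  obtain ⟨⟨p₀, hp₀, hκ₀, hu₀⟩, hleast⟩ := h
  have hp₀mem : p₀ ∈ M.ambiguitySet s := ⟨hp₀, hκ₀⟩
  set g : (Fin A → ℝ) → (Fin A → Fin S → ℝ) → ℝ := fun d p => ∑ a, d a * ∑ i, p a i * z a i with hg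
  have hbdd : ∀ d ∈ stdSimplex ℝ (Fin A), BddBelow (g d '' M.ambiguitySet s) := by
    intro d hd
    refine ⟨∑ a, d a * ∑ i, -|z a i|, ?_⟩
    rintro _ ⟨p, hp, rfl⟩
    refine Finset.sum_le_sum fun a _ => mul_le_mul_of_nonneg_left ?_ (hd.1 a)
    refine Finset.sum_le_sum fun i _ => ?_
    have h0 : 0 ≤ p a i := (hp.1 a).1 i
    have h1 : p a i ≤ 1 := le_one_of_mem_stdSimplex (hp.1 a) i
    nlinarith [neg_abs_le (z a i), abs_nonneg (z a i)]
  have hle : ∀ d ∈ stdSimplex ℝ (Fin A), sInf (g d '' M.ambiguitySet s) ≤ u := fun d hd =>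
    (csInf_le (hbdd d hd) ⟨p₀, hp₀mem, rfl⟩).trans (sum_mul_le_of_mem_stdSimplex hd hu₀)
  have hconv : Convex ℝ ((fun (p : Fin A → Fin S → ℝ) a => ∑ i, p a i * z a i) ''
      M.ambiguitySet s) := by
    rintro _ ⟨p, hp, rfl⟩ _ ⟨p', hp', rfl⟩ a b ha hb hab
    refine ⟨a • p + b • p', convex_ambiguitySet M s hp hp' ha hb hab, ?_⟩
    funext c
    exact sum_combo_mul (p c) (p' c) (z c) a b
  -- If some `p` brought all action values below `u`, the largest of them would be a smaller
  -- feasible value. With no actions at all, `u - 1` would be feasible.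
  obtain ⟨d, hd, hdu⟩ := exists_le_sum_mul hconv ⟨_, p₀, hp₀mem, rfl⟩ (u := u) (by
    rintro _ ⟨p, hp, rfl⟩
    by_contra hlt
    push Not at hlt
    have hne : Nonempty (Fin A) := by
      by_contra hA
      rw [not_nonempty_iff] at hA
      have := hleast (a := u - 1) ⟨p₀, hp₀, hκ₀, fun a => hA.elim a⟩
      linarith
    obtain ⟨a, ha⟩ := Finite.exists_max fun a => ∑ i, p a i * z a i
    exact absurd (hleast ⟨p, hp.1, hp.2, ha⟩) (not_le.2 (hlt a)))
  show sSup ((fun d => sInf (g d '' M.ambiguitySet s)) '' stdSimplex ℝ (Fin A)) = u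
  refine le_antisymm (csSup_le ⟨_, d, hd, rfl⟩ ?_) ?_
  · rintro _ ⟨d', hd', rfl⟩
    exact hle d' hd'
  · refine le_csSup_of_le ⟨u, ?_⟩ ⟨d, hd, rfl⟩ (le_csInf ⟨_, p₀, hp₀mem, rfl⟩ ?_)
    · rintro _ ⟨d', hd', rfl⟩
      exact hle d' hd'
    · rintro _ ⟨p, hp, rfl⟩
      exact hdu _ ⟨p, hp, rfl⟩

theorem val_homotopyBisection (M : RMDP S A) (v : Fin S → ℝ) (s : Fin S) :
    (M.homotopyBisection v s).val = (bisection (M.κ s) fun a =>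
      (homotopy (fun i => M.r s a i + M.γ * v i) (M.w s a) (M.pbar s a)).val).val := by
  simp only [homotopyBisection, val_bind]
  rw [val_forFin_writeCell _ (fun a =>
    (homotopy (fun i => M.r s a i + M.γ * v i) (M.w s a) (M.pbar s a)).val)]
  intro pts a
  simp only [val_bind, val_writeCell]
  rw [val_forFin_writeCell _ (fun i => M.r s a i + M.γ * v i) (fun f i => rfl)]

theorem homotopyBisection_correct (hA : 0 < A) (M : RMDP S A) (v : Fin S → ℝ) (s : Fin S) :
    (M.homotopyBisection v s).val = M.robustBellman v s := by
  rw [val_homotopyBisection]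
  exact (M.robustBellman_eq v s (isLeast_bisection hA (M.w_pos s)
    (fun a => isTrace_homotopy (M.w_pos s a) (M.pbar_mem s a)) (M.κ_nonneg s))).symm

end RMDP

/-! ### Step count of the homotopy method. -/

namespace HomotopyMethod

open Timed

variable {S : ℕ}

theorem steps_cmp_le (b c : Basis S) : (Basis.cmp b c).steps ≤ 3 := by
  simp only [Basis.cmp, steps_bind]
  split_ifs
  · simp
  · simp only [steps_bind]
    split_ifs <;> simp

theorem steps_addBases_le (z w : Fin S → ℝ) (D : List (Basis S)) (i j : Fin S) :
    (addBases z w D i j).steps ≤ 16 := by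
  by_cases h : i = j
  · simp [addBases, h]
  · by_cases h1 : (z i - z j) / (w i + w j) < 0 <;> by_cases h2 : (z i - z j) / (w i - w j) < 0 <;>
    by_cases h3 : w i < w j <;> by_cases h4 : w j < w i <;>
    simp [addBases, h, h1, h2, h3, h4]

theorem length_addBases_le (z w : Fin S → ℝ) (D : List (Basis S)) (i j : Fin S) :
    (addBases z w D i j).val.length ≤ D.length + 2 := by
  by_cases h : i = j
  · simp [addBases, h]
  · by_cases h1 : (z i - z j) / (w i + w j) < 0 <;> by_cases h2 : (z i - z j) / (w i - w j) < 0 <;>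
    by_cases h3 : w i < w j <;> by_cases h4 : w j < w i <;>
    simp [addBases, h, h1, h2, h3, h4]

theorem length_sortedBases_le (z w : Fin S → ℝ) :
    (sortedBases z w).val.length ≤ 2 * S ^ 2 := by
  simp only [sortedBases, val_bind]
  rw [(perm_mergeSort _ _).length_eq]
  refine (length_forFin_le _ _ (S * 2) fun D i =>
    length_forFin_le _ _ 2 fun D j => length_addBases_le z w D i j).trans (le_of_eq ?_)
  simp only [List.length_nil]
  ring

theorem steps_sortedBases_le (z w : Fin S → ℝ) :
    (sortedBases z w).steps ≤ 2 + S * (2 + S * 17) +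
      18 * S ^ 2 * Nat.clog 2 (2 * S ^ 2 + 1) := by
  have h₁ := steps_forFin_le (fun D i => forFin S (fun D j => addBases z w D i j) D)
    ([] : List (Basis S)) _ (fun D i => steps_forFin_le _ D 16
      fun D j => steps_addBases_le z w D i j)
  have h₂ := steps_mergeSort_le Basis.cmp 3 steps_cmp_le
    (forFin S (fun D i => forFin S (fun D j => addBases z w D i j) D) ([] : List (Basis S))).val
  have h₃ : (forFin S (fun D i => forFin S (fun D j => addBases z w D i j) D)
      ([] : List (Basis S))).val.length ≤ 2 * S ^ 2 := by
    have := length_sortedBases_le z w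
    simp only [sortedBases, val_bind] at this
    rwa [(perm_mergeSort _ _).length_eq] at this
  simp only [sortedBases, steps_bind]
  generalize forFin S (fun D i => forFin S (fun D j => addBases z w D i j) D)
    ([] : List (Basis S)) = D at *
  have h₄ : Nat.clog 2 D.val.length ≤ Nat.clog 2 (2 * S ^ 2 + 1) :=
    Nat.clog_mono_right 2 (by omega)
  have h₅ := Nat.mul_le_mul (Nat.mul_le_mul_left 9 h₃) h₄
  linarith

theorem steps_follow (st : State S) (slope W floor : ℝ) (r d : Fin S) :
    (follow st slope W floor r d).steps = 14 := by
  simp [follow]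

theorem length_points_follow (st : State S) (slope W floor : ℝ) (r d : Fin S) :
    (follow st slope W floor r d).val.points.length = st.points.length + 1 := by
  simp [follow]

theorem steps_traceStep_le (w pbar : Fin S → ℝ) (st : State S) (b : Basis S) :
    (traceStep w pbar st b).steps ≤ 30 := by
  simp only [traceStep, steps_bind, steps_readCell, steps_between, steps_tick]
  split_ifs
  · simp only [steps_bind, steps_between, steps_both]
    split_ifs
    · simp only [steps_bind, steps_lt]
      split_ifs <;> simp [steps_follow]
    · simp
  · simp only [steps_bind, steps_between, steps_both]
    split_ifs <;> simp [steps_follow]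

/-- Skipped bases also record a point, so the number of points depends only on the number of bases.
-/
theorem length_points_traceStep (w pbar : Fin S → ℝ) (st : State S) (b : Basis S) :
    (traceStep w pbar st b).val.points.length = st.points.length + 1 := by
  cases h : b.isC2
  · by_cases h₁ : (pbar b.i ≤ st.p b.i ∧ st.p b.i ≤ 1) ∧ 0 ≤ st.p b.j ∧ st.p b.j ≤ pbar b.j
    · simp [traceStep, h, h₁, length_points_follow]
    · simp [traceStep, h, h₁]
  · by_cases h₁ : (pbar b.i ≤ st.p b.i ∧ st.p b.i ≤ 1) ∧ pbar b.j ≤ st.p b.j ∧ st.p b.j ≤ 1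
    · by_cases h₂ : w b.j < w b.i <;> simp [traceStep, h, h₁, h₂, length_points_follow]
    · simp [traceStep, h, h₁]

theorem length_points_trace (w pbar : Fin S → ℝ) (D : List (Basis S)) (st : State S) :
    (forEach (traceStep w pbar) D st).val.points.length = st.points.length + D.length := by
  induction D generalizing st with
  | nil => simp
  | cons b D ih =>
    rw [val_forEach_cons, ih, length_points_traceStep, List.length_cons]
    omega

theorem size_homotopy_le (z w pbar : Fin S → ℝ) :
    (homotopy z w pbar).val.size ≤ 2 * S ^ 2 + 1 := by
  have := length_sortedBases_le z w
  simp only [homotopy, val_bind, val_store, List.size_toArray, length_points_trace, val_cons,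
    List.length_singleton]
  omega

theorem steps_homotopy_le (hS : 1 ≤ S) (z w pbar : Fin S → ℝ) :
    (homotopy z w pbar).steps ≤ 120 * (S ^ 2 * Nat.clog 2 (2 * S ^ 2 + 1)) := by
  have h₀ := length_sortedBases_le z w
  have h₁ := steps_sortedBases_le z w
  have h₂ := fun st => steps_forEach_le (traceStep w pbar) (sortedBases z w).val st
    (fun _ => True) 30 trivial (fun _ _ _ => trivial) (fun st b _ => steps_traceStep_le w pbar st b)
  have h₃ := fun (body : ℝ → Fin S → Timed ℝ) q h => steps_forFin_le body q 4 h
  have hl : 1 ≤ Nat.clog 2 (2 * S ^ 2 + 1) := Nat.clog_pos (by norm_num) (by nlinarith)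
  simp only [homotopy, steps_bind, steps_copy, steps_cons, steps_store, length_points_trace,
    val_cons, List.length_singleton, val_copy]
  have h₄ := h₃ (fun q i => do
      let pi ← readCell pbar i
      let zi ← readCell z i
      let x ← mul pi zi
      add q x) 0 (fun q i => by simp)
  refine (Nat.add_le_add_left (Nat.add_le_add h₄ (Nat.add_le_add_left (Nat.add_le_add h₁
    (Nat.add_le_add_right (h₂ _) _)) _)) _).trans ?_
  generalize Nat.clog 2 (2 * S ^ 2 + 1) = l at *
  have hS2 : S ≤ S ^ 2 := by nlinarith
  have hZ : S ^ 2 ≤ S ^ 2 * l := Nat.le_mul_of_pos_right _ hl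
  nlinarith

end HomotopyMethod

/-! ### Step count of the bisection method. -/

namespace BisectionMethod

open Timed

variable {A : ℕ}

theorem steps_inverse_le (pts : Array (ℝ × ℝ)) (u : ℝ) {N : ℕ} (h : pts.size ≤ N) :
    (inverse pts u).steps ≤ 16 + 7 * Nat.clog 2 N := by
  have h₁ := fun (test : ℕ → Timed Bool) ht => steps_bisect_le test 2 ht 0 (pts.size - 1)
  have h₂ : Nat.clog 2 (pts.size - 1 - 0) ≤ Nat.clog 2 N := Nat.clog_mono_right 2 (by omega)
  have h₃ := h₁ (fun k => readAt pts k (0, 0) >>= fun x => lt u x.2) (fun k => by simp)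
  simp only [inverse, steps_bind, steps_tick, steps_readAt, steps_lt]
  split_ifs
  · simp; omega
  · simp only [steps_bind, steps_readAt, steps_le]
    split_ifs
    · simp; omega
    · simp only [steps_bind, steps_readAt, steps_sub, steps_div, steps_mul, steps_add, steps_pure]
      refine (Nat.add_le_add_left (Nat.add_le_add_left (Nat.add_le_add_left (Nat.add_le_add_left
        (Nat.add_le_add_left (Nat.add_le_add_right h₃ _) _) _) _) _) _).trans ?_
      omega

theorem steps_budget_le (pts : Fin A → Array (ℝ × ℝ)) (u : ℝ) {N : ℕ}
    (h : ∀ a, (pts a).size ≤ N) :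
    (budget pts u).steps ≤ 1 + A * (20 + 7 * Nat.clog 2 N) := by
  refine (steps_forFin_le _ _ (19 + 7 * Nat.clog 2 N) fun s a => ?_).trans (le_of_eq (by ring))
  have := steps_inverse_le (pts a) u (h a)
  simp only [steps_bind, steps_readCell, val_readCell, steps_tick]
  cases s <;> cases (inverse (pts a) u).val <;> simp <;> omega

theorem steps_isFeasible_le (s : Option ℝ) (κ : ℝ) : (isFeasible s κ).steps ≤ 2 := by
  cases s <;> simp [isFeasible]

theorem size_combine_le (pts : Fin A → Array (ℝ × ℝ)) {N : ℕ} (h : ∀ a, (pts a).size ≤ N) :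
    (combine pts).val.size ≤ A * N ∧
    (combine pts).steps ≤ 4 + A * (3 + 3 * N) + 7 * (A * N) * Nat.clog 2 (A * N) + 4 * (A * N) := by
  set body : List ℝ → Fin A → Timed (List ℝ) := fun K a => do
    let l ← readCell pts a
    forFin l.size (fun K k => do
      let (_, q) ← readAt l k (0, 0)
      cons q K) K with hbody
  have hlen : (forFin A body []).val.length ≤ A * N := by
    have := length_forFin_le body [] N fun K a => by
      have := length_forFin_le (fun K (k : Fin (pts a).size) => do
        let (_, q) ← readAt (pts a) k (0, 0)
        cons q K) K 1 (fun K k => by simp)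
      simp only [hbody, val_bind, val_readCell]
      exact this.trans (by simpa using h a)
    simpa using this
  have hsteps : (forFin A body []).steps ≤ 1 + A * (1 + (2 + 3 * N)) := by
    refine steps_forFin_le body [] _ fun K a => ?_
    have := steps_forFin_le (fun K (k : Fin (pts a).size) =>
      readAt (pts a) k (0, 0) >>= fun x => cons x.2 K) K 2 (fun K k => by simp)
    simp only [hbody, steps_bind, val_readCell, steps_readCell]
    have := h a
    omega
  have e : combine pts = (do
    let K ← forFin A body []
    let K ← mergeSort Timed.le K
    let K ← dropDuplicates K
    store K) := rfl
  rw [e]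
  simp only [val_bind, steps_bind, val_store, steps_store, List.size_toArray]
  have h₁ := steps_mergeSort_le Timed.le 1 (fun _ _ => le_rfl) (forFin A body []).val
  have h₂ := (perm_mergeSort Timed.le (forFin A body []).val).length_eq
  have h₃ := length_dropDuplicates_le (mergeSort Timed.le (forFin A body []).val).val
  have h₄ := steps_dropDuplicates_le (mergeSort Timed.le (forFin A body []).val).val
  have h₅ := Nat.mul_le_mul (Nat.mul_le_mul_left 7 hlen) (Nat.clog_mono_right 2 hlen)
  rw [h₂] at h₃ h₄
  refine ⟨h₃.trans hlen, ?_⟩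
  nlinarith

theorem steps_bisection_le (κ : ℝ) (pts : Fin A → Array (ℝ × ℝ)) {N : ℕ}
    (h : ∀ a, (pts a).size ≤ N) :
    (bisection κ pts).steps ≤ (4 + A * (3 + 3 * N) + 7 * (A * N) * Nat.clog 2 (A * N) +
      4 * (A * N)) + 18 + (9 + A * (20 + 7 * Nat.clog 2 N)) * Nat.clog 2 (A * N) +
      2 * (1 + A * (20 + 7 * Nat.clog 2 N)) := by
  obtain ⟨h₁, h₂⟩ := size_combine_le pts h
  have h₃ := steps_bisect_le (fun k => readAt (combine pts).val k 0 >>= fun u =>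
    budget pts u >>= fun s => isFeasible s κ) (4 + A * (20 + 7 * Nat.clog 2 N)) (fun k => by
      have h₄ := steps_budget_le pts ((combine pts).val.getD k 0) h
      have h₅ := steps_isFeasible_le (budget pts ((combine pts).val.getD k 0)).val κ
      simp only [steps_bind, steps_readAt, val_readAt]
      omega) 0 ((combine pts).val.size - 1)
  have h₄ : Nat.clog 2 ((combine pts).val.size - 1 - 0) ≤ Nat.clog 2 (A * N) :=
    Nat.clog_mono_right 2 (by omega)
  have h₅ := Nat.mul_le_mul_left (5 + (4 + A * (20 + 7 * Nat.clog 2 N))) h₄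
  simp only [bisection, steps_bind, steps_tick, steps_readAt, val_readAt]
  generalize (bisect (fun k => readAt (combine pts).val k 0 >>= fun u =>
    budget pts u >>= fun s => isFeasible s κ) 0 ((combine pts).val.size - 1)) = k at *
  have h₆ := steps_budget_le pts ((combine pts).val.getD k.val.1 0) h
  have h₇ := steps_budget_le pts ((combine pts).val.getD k.val.2 0) h
  generalize budget pts ((combine pts).val.getD k.val.1 0) = s at *
  generalize budget pts ((combine pts).val.getD k.val.2 0) = t at *
  -- `n` is the cost of the final case distinction: one comparison and at most seven arithmetic
  -- operations.
  have h₈ : ∀ n ≤ 8, (combine pts).steps + (2 + (k.steps + (1 + (1 + (s.steps + (t.steps +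
      (2 + n))))))) ≤ (4 + A * (3 + 3 * N) + 7 * (A * N) * Nat.clog 2 (A * N) + 4 * (A * N)) + 18 +
      (9 + A * (20 + 7 * Nat.clog 2 N)) * Nat.clog 2 (A * N) +
      2 * (1 + A * (20 + 7 * Nat.clog 2 N)) := by
    intro n hn
    linarith
  refine h₈ _ ?_
  cases s.val with
  | none => simp
  | some s =>
    cases t.val with
    | none => simp
    | some t =>
      simp only [steps_bind, steps_le]
      split_ifs <;> simp

end BisectionMethod

/-! ### Total step count and its logarithmic form. -/

namespace RMDP

open Timed HomotopyMethod BisectionMethod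

variable {S A : ℕ}

theorem steps_homotopyBisection_le (hS : 1 ≤ S) (hA : 1 ≤ A) (M : RMDP S A) (v : Fin S → ℝ)
    (s : Fin S) :
    (M.homotopyBisection v s).steps ≤ 300 * (A * S ^ 2 * Nat.clog 2 (A * (2 * S ^ 2 + 1)) +
      A * Nat.clog 2 (2 * S ^ 2 + 1) * Nat.clog 2 (A * (2 * S ^ 2 + 1))) := by
  set N := 2 * S ^ 2 + 1 with hN
  have hb := steps_bisection_le (M.κ s) (fun a => (homotopy (fun i => M.r s a i + M.γ * v i)
    (M.w s a) (M.pbar s a)).val) (N := N) (fun a => size_homotopy_le _ _ _)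
  set body : (Fin A → Array (ℝ × ℝ)) → Fin A → Timed (Fin A → Array (ℝ × ℝ)) := fun pts a => do
    let z ← alloc S (0 : ℝ)
    let z ← forFin S (fun z i => do
      let vi ← readCell v i
      let ri ← readCell (M.r s a) i
      let x ← mul M.γ vi
      let y ← Timed.add ri x
      writeCell z i y) z
    let l ← HomotopyMethod.homotopy z (M.w s a) (M.pbar s a)
    writeCell pts a l with hbody
  have e : M.homotopyBisection v s = (do
    let pts ← alloc A (#[] : Array (ℝ × ℝ))
    let pts ← forFin A body pts
    BisectionMethod.bisection (M.κ s) pts) := rfl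
  have hval : (forFin A body fun _ => #[]).val = fun a =>
      (homotopy (fun i => M.r s a i + M.γ * v i) (M.w s a) (M.pbar s a)).val := by
    refine val_forFin_writeCell _ _ (fun pts a => ?_) _
    simp only [hbody, val_bind, val_writeCell]
    rw [val_forFin_writeCell _ (fun i => M.r s a i + M.γ * v i) (fun f i => rfl)]
  have hsteps := steps_forFin_le body (fun _ => #[])
    (S + (1 + S * 6) + 120 * (S ^ 2 * Nat.clog 2 N) + 1) (fun pts a => by
      have h₁ := steps_forFin_le (fun (z : Fin S → ℝ) i => do
        let vi ← readCell v i
        let ri ← readCell (M.r s a) i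
        let x ← mul M.γ vi
        let y ← Timed.add ri x
        writeCell z i y) (fun _ => 0) 5 (fun z i => by simp)
      have h₂ := fun z => steps_homotopy_le hS z (M.w s a) (M.pbar s a)
      rw [← hN] at h₂
      simp only [hbody, steps_bind, steps_alloc, steps_writeCell, val_alloc]
      refine (Nat.add_le_add_left (Nat.add_le_add h₁ (Nat.add_le_add_right (h₂ _) _)) _).trans ?_
      omega)
  rw [e]
  simp only [steps_bind, steps_alloc, val_alloc]
  rw [hval]
  have hl : 1 ≤ Nat.clog 2 N := Nat.clog_pos (by norm_num) (by nlinarith)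
  have hlL : Nat.clog 2 N ≤ Nat.clog 2 (A * N) :=
    Nat.clog_mono_right 2 (Nat.le_mul_of_pos_left _ hA)
  generalize Nat.clog 2 (A * N) = L at *
  generalize Nat.clog 2 N = l at *
  have hL : 1 ≤ L := hl.trans hlL
  have hS2 : S ≤ S ^ 2 := by nlinarith
  have hAS : A ≤ A * S ^ 2 := Nat.le_mul_of_pos_right _ (by positivity)
  have hASS : A * S ≤ A * S ^ 2 := Nat.mul_le_mul_left A hS2
  have hX : A * S ^ 2 ≤ A * S ^ 2 * L := Nat.le_mul_of_pos_right _ hL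
  have hXl : A * S ^ 2 * l ≤ A * S ^ 2 * L := Nat.mul_le_mul_left _ hlL
  have hAL : A * L ≤ A * S ^ 2 * L := Nat.mul_le_mul_right L hAS
  have hLL : L ≤ A * L := Nat.le_mul_of_pos_left _ hA
  have hY : A * l ≤ A * l * L := Nat.le_mul_of_pos_right _ hL
  have hAN : A * N = 2 * (A * S ^ 2) + A := by rw [hN]; ring
  have hANL : A * N * L = 2 * (A * S ^ 2 * L) + A * L := by rw [hAN]; ring
  have h₁ : A * (3 + 3 * N) = 3 * A + 3 * (A * N) := by ring
  have h₂ : (9 + A * (20 + 7 * l)) * L = 9 * L + 20 * (A * L) + 7 * (A * l * L) := by ring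
  have h₃ : A * (20 + 7 * l) = 20 * A + 7 * (A * l) := by ring
  have h₄ : A * (1 + (S + (1 + S * 6) + 120 * (S ^ 2 * l) + 1)) =
      3 * A + 7 * (A * S) + 120 * (A * S ^ 2 * l) := by ring
  rw [h₄] at hsteps
  rw [h₁, mul_assoc 7, hANL, h₂, h₃, hAN] at hb
  refine (Nat.add_le_add_left (Nat.add_le_add hsteps hb) _).trans ?_
  -- All lower-order terms have been compared with `A * S ^ 2 * L` and `A * l * L`; with the
  -- products as atoms the rest is linear.
  generalize A * S ^ 2 * L = X at *
  generalize A * l * L = Y at *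
  generalize A * S ^ 2 * l = Z at *
  generalize A * S ^ 2 = U at *
  generalize A * S = V at *
  generalize A * L = W at *
  generalize A * l = R at *
  omega

theorem clog_two_le {n : ℕ} (hn : 1 ≤ n) : (Nat.clog 2 n : ℝ) ≤ Real.log n / Real.log 2 + 1 := by
  have h₁ : Nat.clog 2 n ≤ Nat.log 2 n + 1 := Nat.clog_le_of_le_pow (Nat.lt_pow_succ_log_self
    (by norm_num) n).le
  have h₂ : (2 : ℝ) ^ Nat.log 2 n ≤ n := by exact_mod_cast Nat.pow_log_le_self 2 (by omega)
  have h₃ := Real.log_le_log (by positivity) h₂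
  rw [Real.log_pow] at h₃
  have h₄ : (Nat.log 2 n : ℝ) ≤ Real.log n / Real.log 2 :=
    (le_div_iff₀ (Real.log_pos (by norm_num))).2 h₃
  have h₅ : (Nat.clog 2 n : ℝ) ≤ Nat.log 2 n + 1 := by exact_mod_cast h₁
  linarith

theorem exists_steps_bound : ∃ C : ℝ, ∀ (S A : ℕ), 2 ≤ S * A → ∀ (M : RMDP S A) (v : Fin S → ℝ)
    (s : Fin S), ((M.homotopyBisection v s).steps : ℝ) ≤
      C * ((S : ℝ) ^ 2 * A * Real.log ((S : ℝ) * A) +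
        A * Real.log S * Real.log ((S : ℝ) * A)) := by
  have hlog2 : 1 / 2 < Real.log 2 := by linarith [Real.log_two_gt_d9]
  -- With the two logarithm estimates below, the bracket multiplied by `300` is at most `60` times
  -- the first term plus `40` times the second, so `160` is ample.
  refine ⟨300 * 8 * 20, fun S A hSA M v s => ?_⟩
  have hS : 1 ≤ S := Nat.pos_of_ne_zero (by rintro rfl; simp at hSA)
  have hA : 1 ≤ A := Nat.pos_of_ne_zero (by rintro rfl; simp at hSA)
  have hSr : (1 : ℝ) ≤ S := by exact_mod_cast hS
  have hAr : (1 : ℝ) ≤ A := by exact_mod_cast hA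
  have hSAr : (2 : ℝ) ≤ S * A := by exact_mod_cast hSA
  have hlogS : 0 ≤ Real.log S := Real.log_nonneg hSr
  have hlog : Real.log 2 ≤ Real.log (S * A) := Real.log_le_log (by norm_num) hSAr
  have hmain : ((M.homotopyBisection v s).steps : ℝ) ≤
      300 * (A * S ^ 2 * Nat.clog 2 (A * (2 * S ^ 2 + 1)) +
      A * Nat.clog 2 (2 * S ^ 2 + 1) * Nat.clog 2 (A * (2 * S ^ 2 + 1))) := by
    exact_mod_cast steps_homotopyBisection_le hS hA M v s
  have hdiv : ∀ x : ℝ, 0 ≤ x → x / Real.log 2 ≤ 2 * x := by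
    intro x hx
    rw [div_le_iff₀ (by linarith)]
    nlinarith
  have hl : (Nat.clog 2 (2 * S ^ 2 + 1) : ℝ) ≤ 4 * Real.log S + 5 := by
    refine (clog_two_le (by omega)).trans ?_
    have h₁ : Real.log ((2 * S ^ 2 + 1 : ℕ) : ℝ) ≤ Real.log (2 ^ 2 * (S : ℝ) ^ 2) := by
      refine Real.log_le_log (by positivity) ?_
      push_cast
      nlinarith
    rw [Real.log_mul (by positivity) (by positivity), Real.log_pow, Real.log_pow] at h₁
    have h₂ := div_le_div_of_nonneg_right h₁ (show 0 ≤ Real.log 2 by linarith)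
    rw [add_div, mul_div_cancel_right₀ _ (by linarith : Real.log 2 ≠ 0)] at h₂
    have h₃ := hdiv (((2 : ℕ) : ℝ) * Real.log S) (by positivity)
    push_cast at h₂ h₃ ⊢
    linarith
  -- From `SA ≥ 2` follow both `A (2S² + 1) ≤ (SA)⁴` and `log(SA) > 1 / 2`; the latter absorbs the
  -- rounding of `Nat.clog`.
  have hL : (Nat.clog 2 (A * (2 * S ^ 2 + 1)) : ℝ) ≤ 10 * Real.log (S * A) := by
    refine (clog_two_le (Nat.mul_pos hA (by omega))).trans ?_
    have h₁ : Real.log ((A * (2 * S ^ 2 + 1) : ℕ) : ℝ) ≤ Real.log (((S : ℝ) * A) ^ 4) := by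
      refine Real.log_le_log (by positivity) ?_
      push_cast
      have h₂ : (2 * (S : ℝ) ^ 2 + 1) ≤ 4 * S ^ 2 := by nlinarith
      have h₃ : (A : ℝ) * (4 * S ^ 2) ≤ (S * A) ^ 2 * (S * A) ^ 2 := by
        have h₄ : (4 : ℝ) ≤ (S * A) ^ 2 := by nlinarith
        have h₅ : (A : ℝ) * S ^ 2 ≤ (S * A) ^ 2 := by
          have : (A : ℝ) ≤ A ^ 2 := by nlinarith
          nlinarith [sq_nonneg (S : ℝ)]
        nlinarith
      calc (A : ℝ) * (2 * S ^ 2 + 1) ≤ A * (4 * S ^ 2) := by gcongr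
        _ ≤ ((S : ℝ) * A) ^ 2 * (S * A) ^ 2 := h₃
        _ = ((S : ℝ) * A) ^ 4 := by ring
    rw [Real.log_pow] at h₁
    have h₂ := div_le_div_of_nonneg_right h₁ (show 0 ≤ Real.log 2 by linarith)
    have h₃ := hdiv (((4 : ℕ) : ℝ) * Real.log (S * A)) (by push_cast; linarith)
    push_cast at h₂ h₃ ⊢
    linarith
  refine hmain.trans ?_
  have hA0 : (0 : ℝ) ≤ A := by positivity
  have hl0 : (0 : ℝ) ≤ 4 * Real.log S + 5 := by linarith
  have hlog0 : 0 ≤ Real.log (S * A) := by linarith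
  have h₁ : (A : ℝ) * S ^ 2 * Nat.clog 2 (A * (2 * S ^ 2 + 1)) ≤
      A * S ^ 2 * (10 * Real.log (S * A)) := by gcongr
  have h₂ : (A : ℝ) * Nat.clog 2 (2 * S ^ 2 + 1) * Nat.clog 2 (A * (2 * S ^ 2 + 1)) ≤
      A * (4 * Real.log S + 5) * (10 * Real.log (S * A)) := by gcongr
  -- The additive constant in the bound for `log N` survives when `S = 1` and `log S = 0`; it is
  -- charged to the term `S²A log(SA)`.
  have h₃ : (A : ℝ) * Real.log (S * A) ≤ S ^ 2 * A * Real.log (S * A) := by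
    have : (1 : ℝ) ≤ S ^ 2 := by nlinarith
    have h₄ : (A : ℝ) ≤ S ^ 2 * A := by nlinarith
    exact mul_le_mul_of_nonneg_right h₄ hlog0
  have h₅ : 0 ≤ (A : ℝ) * Real.log S * Real.log (S * A) := by positivity
  nlinarith

end RMDP

theorem mainTheorem5 :
    (∀ (S A : ℕ), 0 < A → ∀ (M : RMDP S A) (v : Fin S → ℝ) (s : Fin S),
      (M.homotopyBisection v s).val = M.robustBellman v s) ∧
    ∃ C : ℝ, ∀ (S A : ℕ), 2 ≤ S * A → ∀ (M : RMDP S A) (v : Fin S → ℝ) (s : Fin S),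
      ((M.homotopyBisection v s).steps : ℝ) ≤
        C * ((S : ℝ) ^ 2 * A * Real.log ((S : ℝ) * A) +
          A * Real.log S * Real.log ((S : ℝ) * A)) := by
  exact ⟨fun _ _ hA M v s => M.homotopyBisection_correct hA v s, RMDP.exists_steps_bound⟩
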